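/- Let $(\mathscr A,E)$ be a tracial $W^*$-probability space: $\mathscr A$ is a von Neumann algebra of operators on a Hilbert space and $E$ is a unital, weakly continuous (normal), positive, faithful, tracial linear functional on $\mathscr A$. The law of a self-adjoint $a\in\mathscr A$ is the unique Borel probability measure $\mu$ on $\mathbb R$ such that $E(a^m)=\int_{\mathbb R}t^m\,d\mu(t)$ for every integer $m\ge 0$. Let $x,y\in\mathscr A$ be self-adjoint and freely independent (that is, $E(a_1\cdots a_m)=0$ whenever $m\ge 1$, each $a_j$ lies in the unital algebra generated by $x$ or in the one generated by $y$, neighbouring factors are taken from different ones, and $E(a_j)=0$ for all $j$), both with the semicircular law $\frac1{2\pi}\sqrt{4-u^2}\,\mathbf 1_{(-2,2)}(u)\,du$. The law of $\frac1{\sqrt2}(xy+yx)$ is called the tetilla law. **Proposition.** The tetilla law admits the compactly supported (nonnegative, measurable) density $h$ with respect to Lebesgue measure given by $$h(t)=\frac{1}{2\sqrt3\,\pi\,|t|}\left[\sqrt[3]{1+36t^2+3\sqrt{6t^2+132t^4-24t^6}}-\sqrt[3]{1+36t^2-3\sqrt{6t^2+132t^4-24t^6}}\,\right]$$ for $t\in\left[-\frac{\sqrt{11+5\sqrt5}}2,\frac{\sqrt{11+5\sqrt5}}2\right]$,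 $t\neq 0$, and $h(t)=0$ otherwise (the value at the single point $t=0$ is immaterial). -/

import Mathlib

open MeasureTheory
open scoped ComplexOrder

/-- A tracial `W*`-probability space `(𝒜, E)`, with `𝒜` a von Neumann algebra of bounded operators
on the Hilbert space `H`, and `E` a unital linear functional on `𝒜` which is weakly continuous,
positive, faithful and tracial. -/
structure TracialWStarProbabilitySpace (H : Type*) [NormedAddCommGroup H] [InnerProductSpace ℂ H]
    [CompleteSpace H] where
  /-- The von Neumann algebra `𝒜`. -/
  algebra : VonNeumannAlgebra H
  /-- The functional `E`. -/
  E : algebra.toStarSubalgebra →ₗ[ℂ] ℂ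
  map_one : E 1 = 1
  /-- `E` is continuous, on each bounded part of `𝒜`, for the weak operator topology
  (equivalently: `E` is ultraweakly continuous, i.e. normal). -/
  weakly_continuous : ∀ r : ℝ,
    @ContinuousOn _ _
      (TopologicalSpace.induced
        (fun a : algebra.toStarSubalgebra =>
          (ContinuousLinearMapWOT.ofCLM (a : H →L[ℂ] H) : H →WOT[ℂ] H)) inferInstance)
      _ E {a | ‖(a : H →L[ℂ] H)‖ ≤ r}
  positive : ∀ a, 0 ≤ E (a * star a)
  faithful : ∀ a, E (a * star a) = 0 → a = 0
  tracial : ∀ a b, E (a * b) = E (b * a)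

namespace TracialWStarProbabilitySpace

variable {H : Type*} [NormedAddCommGroup H] [InnerProductSpace ℂ H] [CompleteSpace H]

/-- The elements of the von Neumann algebra `𝒜` underlying the space `(𝒜, E)`. -/
abbrev Elem (P : TracialWStarProbabilitySpace H) : Type _ := P.algebra.toStarSubalgebra

/-- `μ` is a law of `a`: a Borel probability measure on `ℝ` with `E (a ^ m) = ∫ t ^ m dμ(t)` for all
`m ≥ 0`, all these moments being finite. -/
def IsLaw (P : TracialWStarProbabilitySpace H) (a : P.Elem) (μ : Measure ℝ) : Prop :=
  IsProbabilityMeasure μ ∧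
    ∀ m : ℕ, Integrable (fun t : ℝ => t ^ m) μ ∧ P.E (a ^ m) = ((∫ t : ℝ, t ^ m ∂μ : ℝ) : ℂ)

/-- Free independence of a family of unital subalgebras of `𝒜`: `E (a₀ a₁ ⋯ aₘ) = 0` whenever all
the `aⱼ` are centered and neighbouring factors are taken from different subalgebras. -/
def FreeSubalgebras (P : TracialWStarProbabilitySpace H) {ι : Type*}
    (S : ι → Subalgebra ℂ P.Elem) : Prop :=
  ∀ (m : ℕ) (i : Fin (m + 1) → ι) (a : Fin (m + 1) → P.Elem),
    (∀ j, a j ∈ S (i j)) → (∀ j, P.E (a j) = 0) →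
    (∀ j : Fin m, i j.castSucc ≠ i j.succ) →
    P.E (List.ofFn a).prod = 0

/-- Free independence of a family of random variables: the unital subalgebras that they generate
are freely independent. -/
def Free (P : TracialWStarProbabilitySpace H) {ι : Type*} (x : ι → P.Elem) : Prop :=
  P.FreeSubalgebras fun i => Algebra.adjoin ℂ {x i}

end TracialWStarProbabilitySpace

/-- The centered semicircular distribution `S(0, v)` of parameter (variance) `v > 0`. -/
noncomputable def semicircularLaw (v : ℝ) : Measure ℝ :=
  volume.withDensity fun u => ENNReal.ofReal
    ((Set.Ioo (-(2 * √v)) (2 * √v)).indicator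
      (fun u => 1 / (2 * Real.pi * v) * √(4 * v - u ^ 2)) u)

/-- The density `h` of the tetilla law. Both radicands of the cube roots are positive for
`|t| ≤ √(11 + 5√5) / 2`. The value at the single point `t = 0`, where the formula has no
meaning, is immaterial. -/
noncomputable def tetillaDensity (t : ℝ) : ℝ :=
  (Set.Icc (-(√(11 + 5 * √5) / 2)) (√(11 + 5 * √5) / 2)).indicator
    (fun t => 1 / (2 * √3 * Real.pi * |t|) *
      ((1 + 36 * t ^ 2 + 3 * √(6 * t ^ 2 + 132 * t ^ 4 - 24 * t ^ 6)) ^ (1 / 3 : ℝ)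
        - (1 + 36 * t ^ 2 - 3 * √(6 * t ^ 2 + 132 * t ^ 4 - 24 * t ^ 6)) ^ (1 / 3 : ℝ))) t

/-! The law has bounded support, so its moments determine it (`measure_eq_of_moments_eq`). The proof
shows that the moment series of `(xy + yx)/√2` and that of the density `h` solve the same cubic
equation, which has only one formal solution (`eq_of_cubic`).

Algebraic side. Free semicircular variables satisfy `E (z i * w) = (E ⊗ E) (∂ᵢ w)`
(`schwingerDyson`): both sides are linear in `w`, and they agree on alternating products of centered
elements, which span the free algebra. Applied to words built from powers of `t = xy + yx`, this
equation closes up into a finite system of convolution identities. Elimination gives `M = 1 + X² (M²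
+ M³)` for the moment series of `t` (`SchwingerDyson.cubic`); dividing `t` by `√2` puts a factor
`1/2` before `X²`.

Analytic side. In terms of `G = w M(w)` the rescaled cubic reads `w (2 + G²) = G (2 - G²)`, so `t =
1/w` is a rational function of `G`. There is a curve in the closed upper half-plane on which this
`t` is real, and along it `h(t) = Im G / π`, by Cardano's formula (`tetillaCont_eq_of_param`). Hence
`w ∫ h(t) / (1 - w t) dt` is `1/π` times the imaginary part of `∫ G d log(1 - w t)` along the curve.
As `1 - w t` is rational in `G`, partial fractions reduce this to integrals of `dG / (G - a)` with
`a` real. Such an integral has imaginary part `π` if `a` lies between the real endpoints of the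
curve and `0` if `a` lies outside. Only the small root `a = g` of the cubic lies between them, so
the transform equals `g` (`integral_tetillaCont_div`). This holds for all small `g`, and isolation
of zeros turns it into an identity of power series (`tetillaMoment_cubic`). -/

open scoped TensorProduct

/-! ### Free difference quotients and the Schwinger-Dyson equation -/

section FreeDifferenceQuotient

variable {ι B : Type*} [Ring B] [Algebra ℂ B]

/-- The algebra homomorphism `w ↦ !![w ⊗ 1, ∂ᵢ w; 0, 1 ⊗ w]`, which encodes the free difference
quotient `∂ᵢ` evaluated at the family `z`. -/
noncomputable def freeDiffHom [DecidableEq ι] (z : ι → B) (i : ι) :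
    FreeAlgebra ℂ ι →ₐ[ℂ] Matrix (Fin 2) (Fin 2) (B ⊗[ℂ] B) :=
  FreeAlgebra.lift ℂ fun k => !![z k ⊗ₜ 1, if k = i then 1 else 0; 0, 1 ⊗ₜ z k]

/-- The `i`-th free difference quotient, evaluated at the family `z`. -/
noncomputable def freeDiff [DecidableEq ι] (z : ι → B) (i : ι) (w : FreeAlgebra ℂ ι) : B ⊗[ℂ] B :=
  freeDiffHom z i w 0 1

lemma freeDiffHom_entries [DecidableEq ι] (z : ι → B) (i : ι) (w : FreeAlgebra ℂ ι) :
    freeDiffHom z i w 0 0 = FreeAlgebra.lift ℂ z w ⊗ₜ 1 ∧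
    freeDiffHom z i w 1 1 = 1 ⊗ₜ FreeAlgebra.lift ℂ z w ∧ freeDiffHom z i w 1 0 = 0 := by
  induction w using FreeAlgebra.induction with
  | grade0 r =>
    simp [Algebra.algebraMap_eq_smul_one, TensorProduct.smul_tmul',
      Algebra.TensorProduct.one_def, TensorProduct.tmul_smul]
  | grade1 x => simp [freeDiffHom]
  | mul a b ha hb =>
    simp [map_mul, Matrix.mul_apply, Fin.sum_univ_two, ha, hb]
  | add a b ha hb =>
    simp [map_add, ha, hb, TensorProduct.add_tmul, TensorProduct.tmul_add]

/-- The Leibniz rule is the corner entry of a product of upper triangular matrices. -/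
lemma freeDiff_mul [DecidableEq ι] (z : ι → B) (i : ι) (u v : FreeAlgebra ℂ ι) :
    freeDiff z i (u * v) = (FreeAlgebra.lift ℂ z u ⊗ₜ 1) * freeDiff z i v
      + freeDiff z i u * (1 ⊗ₜ FreeAlgebra.lift ℂ z v) := by
  simp only [freeDiff, map_mul, Matrix.mul_apply, Fin.sum_univ_two, freeDiffHom_entries]

lemma freeDiff_add [DecidableEq ι] (z : ι → B) (i : ι) (u v : FreeAlgebra ℂ ι) :
    freeDiff z i (u + v) = freeDiff z i u + freeDiff z i v := by
  simp [freeDiff]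

lemma freeDiff_smul [DecidableEq ι] (z : ι → B) (i : ι) (c : ℂ) (u : FreeAlgebra ℂ ι) :
    freeDiff z i (c • u) = c • freeDiff z i u := by
  simp [freeDiff]

lemma freeDiff_algebraMap [DecidableEq ι] (z : ι → B) (i : ι) (c : ℂ) :
    freeDiff z i (algebraMap ℂ _ c) = 0 := by
  simp [freeDiff, AlgHom.commutes, Matrix.algebraMap_matrix_apply]

lemma freeDiff_one [DecidableEq ι] (z : ι → B) (i : ι) : freeDiff z i 1 = 0 := by
  simp [freeDiff]

lemma freeDiff_ι [DecidableEq ι] (z : ι → B) (i k : ι) :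
    freeDiff z i (FreeAlgebra.ι ℂ k) = if k = i then 1 else 0 := by
  simp [freeDiff, freeDiffHom]

lemma freeDiff_pow [DecidableEq ι] (z : ι → B) (i : ι) (u : FreeAlgebra ℂ ι) (n : ℕ) :
    freeDiff z i (u ^ n) = ∑ j ∈ Finset.range n,
      ((FreeAlgebra.lift ℂ z u ^ j) ⊗ₜ 1) * freeDiff z i u *
        (1 ⊗ₜ (FreeAlgebra.lift ℂ z u ^ (n - 1 - j))) := by
  induction n with
  | zero => simp [freeDiff_one]
  | succ n ih =>
    rw [pow_succ, freeDiff_mul, ih, Finset.sum_range_succ, add_comm, Finset.sum_mul]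
    congr 1
    · refine Finset.sum_congr rfl fun j hj => ?_
      have hj := Finset.mem_range.1 hj
      rw [mul_assoc, mul_assoc, mul_assoc]
      congr 2
      rw [Algebra.TensorProduct.tmul_mul_tmul, one_mul, ← pow_succ]
      congr 2
      omega
    · rw [show n + 1 - 1 - n = 0 by omega, pow_zero, ← Algebra.TensorProduct.one_def,
        mul_one, map_pow]

lemma freeDiff_eq_zero_of_mem_adjoin [DecidableEq ι] (z : ι → B) {i k : ι} (hk : k ≠ i)
    {p : FreeAlgebra ℂ ι}
    (hp : p ∈ Algebra.adjoin ℂ {FreeAlgebra.ι ℂ k}) : freeDiff z i p = 0 := by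
  induction hp using Algebra.adjoin_induction with
  | mem x hx => rw [Set.mem_singleton_iff.1 hx, freeDiff_ι, if_neg hk]
  | algebraMap r => exact freeDiff_algebraMap z i r
  | add x y _ _ hx hy => rw [freeDiff_add, hx, hy, add_zero]
  | mul x y _ _ hx hy => rw [freeDiff_mul, hx, hy, mul_zero, zero_mul, add_zero]

/-- Both legs of `∂ᵢ p` stay in the algebra of the `i`-th variable, so each can stand in for the
letter `p` of an alternating word without breaking the alternation. -/
lemma freeDiff_mem_span [DecidableEq ι] (z : ι → B) (i : ι) {p : FreeAlgebra ℂ ι}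
    (hp : p ∈ Algebra.adjoin ℂ {FreeAlgebra.ι ℂ i}) :
    freeDiff z i p ∈ Submodule.span ℂ {t | ∃ a ∈ Algebra.adjoin ℂ {FreeAlgebra.ι ℂ i},
      ∃ b ∈ Algebra.adjoin ℂ {FreeAlgebra.ι ℂ i},
      t = FreeAlgebra.lift ℂ z a ⊗ₜ[ℂ] FreeAlgebra.lift ℂ z b} := by
  induction hp using Algebra.adjoin_induction with
  | mem x hx =>
    rw [Set.mem_singleton_iff.1 hx, freeDiff_ι, if_pos rfl]
    exact Submodule.subset_span ⟨1, one_mem _, 1, one_mem _, by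
      simp [Algebra.TensorProduct.one_def]⟩
  | algebraMap r => rw [freeDiff_algebraMap]; exact zero_mem _
  | add x y _ _ hx hy => rw [freeDiff_add]; exact add_mem hx hy
  | mul x y hx' hy' hx hy =>
    rw [freeDiff_mul]
    refine add_mem ?_ ?_
    · refine Submodule.span_induction (p := fun t _ => (FreeAlgebra.lift ℂ z x ⊗ₜ 1) * t ∈ _)
        ?_ ?_ ?_ ?_ hy
      · rintro _ ⟨a, ha, b, hb, rfl⟩
        exact Submodule.subset_span ⟨x * a, mul_mem hx' ha, b, hb, by simp⟩
      · rw [mul_zero]; exact zero_mem _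
      · intro s t _ _ hs ht
        rw [mul_add]; exact add_mem hs ht
      · intro c t _ ht
        rw [mul_smul_comm]; exact Submodule.smul_mem _ _ ht
    · refine Submodule.span_induction (p := fun t _ => t * (1 ⊗ₜ FreeAlgebra.lift ℂ z y) ∈ _)
        ?_ ?_ ?_ ?_ hx
      · rintro _ ⟨a, ha, b, hb, rfl⟩
        exact Submodule.subset_span ⟨a, ha, b * y, mul_mem hb hy', by simp⟩
      · rw [zero_mul]; exact zero_mem _
      · intro s t _ _ hs ht
        rw [add_mul]; exact add_mem hs ht
      · intro c t _ ht
        rw [smul_mul_assoc]; exact Submodule.smul_mem _ _ ht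

/-- The functional `E ⊗ E`. -/
noncomputable def tensorSq (E : B →ₗ[ℂ] ℂ) : B ⊗[ℂ] B →ₗ[ℂ] ℂ :=
  LinearMap.mul' ℂ ℂ ∘ₗ TensorProduct.map E E

@[simp] lemma tensorSq_tmul (E : B →ₗ[ℂ] ℂ) (a b : B) : tensorSq E (a ⊗ₜ b) = E a * E b := by
  simp [tensorSq]

/-- A list of centered elements of the algebras generated by the free variables, neighbours being
taken from different ones. -/
def IsAltCentered (E : B →ₗ[ℂ] ℂ) (z : ι → B) (l : List (ι × FreeAlgebra ℂ ι)) : Prop :=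
  l.IsChain (fun a b => a.1 ≠ b.1) ∧
    ∀ a ∈ l, a.2 ∈ Algebra.adjoin ℂ {FreeAlgebra.ι ℂ a.1} ∧ E (FreeAlgebra.lift ℂ z a.2) = 0

/-- The product of a list of elements of the free algebra. -/
def listProd (l : List (ι × FreeAlgebra ℂ ι)) : FreeAlgebra ℂ ι := (l.map Prod.snd).prod

/-- Freeness, expressed with lists. -/
def ListFree (E : B →ₗ[ℂ] ℂ) (z : ι → B) : Prop :=
  ∀ l, IsAltCentered E z l → l ≠ [] → E (FreeAlgebra.lift ℂ z (listProd l)) = 0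

variable {E : B →ₗ[ℂ] ℂ} {z : ι → B}

lemma IsAltCentered.of_append_left {l l' : List (ι × FreeAlgebra ℂ ι)}
    (h : IsAltCentered E z (l ++ l')) : IsAltCentered E z l :=
  ⟨(List.isChain_append.1 h.1).1, fun a ha => h.2 a (List.mem_append_left _ ha)⟩

lemma IsAltCentered.of_append_right {l l' : List (ι × FreeAlgebra ℂ ι)}
    (h : IsAltCentered E z (l ++ l')) : IsAltCentered E z l' :=
  ⟨(List.isChain_append.1 h.1).2.1, fun a ha => h.2 a (List.mem_append_right _ ha)⟩

lemma IsAltCentered.tail {a : ι × FreeAlgebra ℂ ι} {l : List (ι × FreeAlgebra ℂ ι)}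
    (h : IsAltCentered E z (a :: l)) : IsAltCentered E z l :=
  IsAltCentered.of_append_right (l := [a]) h

/-- The centering of an element of the free algebra. -/
noncomputable def centering (E : B →ₗ[ℂ] ℂ) (z : ι → B) (p : FreeAlgebra ℂ ι) : FreeAlgebra ℂ ι :=
  p - algebraMap ℂ _ (E (FreeAlgebra.lift ℂ z p))

lemma centering_mem {p : FreeAlgebra ℂ ι} {k : ι}
    (hp : p ∈ Algebra.adjoin ℂ {FreeAlgebra.ι ℂ k}) :
    centering E z p ∈ Algebra.adjoin ℂ {FreeAlgebra.ι ℂ k} :=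
  sub_mem hp (Subalgebra.algebraMap_mem _ _)

lemma map_centering (h1 : E 1 = 1) (p : FreeAlgebra ℂ ι) :
    E (FreeAlgebra.lift ℂ z (centering E z p)) = 0 := by
  simp [centering, Algebra.algebraMap_eq_smul_one, h1]

lemma eq_centering_add (p : FreeAlgebra ℂ ι) :
    p = centering E z p + algebraMap ℂ _ (E (FreeAlgebra.lift ℂ z p)) := by
  simp [centering]

lemma IsAltCentered.replace_head {k : ι} {a p : FreeAlgebra ℂ ι}
    {l : List (ι × FreeAlgebra ℂ ι)} (h : IsAltCentered E z ((k, a) :: l))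
    (hp : p ∈ Algebra.adjoin ℂ {FreeAlgebra.ι ℂ k}) (hp0 : E (FreeAlgebra.lift ℂ z p) = 0) :
    IsAltCentered E z ((k, p) :: l) := by
  refine ⟨?_, ?_⟩
  · have := h.1
    rw [List.isChain_cons] at this ⊢
    exact this
  · intro b hb
    rcases List.mem_cons.1 hb with rfl | hb
    · exact ⟨hp, hp0⟩
    · exact h.2 b (List.mem_cons_of_mem _ hb)

lemma IsAltCentered.replace_last {k : ι} {a p : FreeAlgebra ℂ ι}
    {l : List (ι × FreeAlgebra ℂ ι)} (h : IsAltCentered E z (l ++ [(k, a)]))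
    (hp : p ∈ Algebra.adjoin ℂ {FreeAlgebra.ι ℂ k}) (hp0 : E (FreeAlgebra.lift ℂ z p) = 0) :
    IsAltCentered E z (l ++ [(k, p)]) := by
  refine ⟨?_, ?_⟩
  · have := h.1
    rw [List.isChain_append] at this ⊢
    simpa using this
  · intro b hb
    rcases List.mem_append.1 hb with hb | hb
    · exact h.2 b (List.mem_append_left _ hb)
    · rw [List.mem_singleton] at hb
      subst hb
      exact ⟨hp, hp0⟩

/-- Centering `p` leaves two alternating centered words, one with head `k` and one without it. Both
are nonempty since `l ≠ []`, so freeness kills both. -/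
lemma ListFree.map_head_mul (hf : ListFree E z) (h1 : E 1 = 1) {k : ι} {a p : FreeAlgebra ℂ ι}
    {l : List (ι × FreeAlgebra ℂ ι)} (h : IsAltCentered E z ((k, a) :: l)) (hl : l ≠ [])
    (hp : p ∈ Algebra.adjoin ℂ {FreeAlgebra.ι ℂ k}) :
    E (FreeAlgebra.lift ℂ z (p * listProd l)) = 0 := by
  have e1 := hf _ (h.replace_head (centering_mem hp) (map_centering h1 p)) (by simp)
  have e2 := hf _ h.tail hl
  rw [eq_centering_add (E := E) (z := z) p, add_mul, map_add, map_add, ← Algebra.smul_def,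
    map_smul, map_smul, e2, smul_zero, add_zero]
  simpa [listProd] using e1

lemma ListFree.map_mul_last (hf : ListFree E z) (h1 : E 1 = 1) {k : ι} {a p : FreeAlgebra ℂ ι}
    {l : List (ι × FreeAlgebra ℂ ι)} (h : IsAltCentered E z (l ++ [(k, a)])) (hl : l ≠ [])
    (hp : p ∈ Algebra.adjoin ℂ {FreeAlgebra.ι ℂ k}) :
    E (FreeAlgebra.lift ℂ z (listProd l * p)) = 0 := by
  have e1 := hf _ (h.replace_last (centering_mem hp) (map_centering h1 p)) (by simp)
  have e2 := hf _ h.of_append_left hl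
  rw [eq_centering_add (E := E) (z := z) p, mul_add, map_add, map_add, ← Algebra.commutes,
    ← Algebra.smul_def, map_smul, map_smul, e2, smul_zero, add_zero]
  simpa [listProd] using e1

/-- When `∂ᵢ` hits a letter of `c`, the left leg is the nonempty word before that letter times a
factor from the same algebra as the letter, and `E` kills it. The induction moves letters from `c`
to `b`. -/
lemma ListFree.tensorSq_mul_freeDiff [DecidableEq ι] (hf : ListFree E z) (h1 : E 1 = 1) (i : ι)
    (c : List (ι × FreeAlgebra ℂ ι)) :
    ∀ b : List (ι × FreeAlgebra ℂ ι), b ≠ [] → IsAltCentered E z (b ++ c) →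
      tensorSq E ((FreeAlgebra.lift ℂ z (listProd b) ⊗ₜ 1) * freeDiff z i (listProd c)) = 0 := by
  induction c with
  | nil => intro b _ _; simp [listProd, freeDiff_one]
  | cons ka c ih =>
    obtain ⟨k, a⟩ := ka
    intro b hb h
    have hbc : IsAltCentered E z ((b ++ [(k, a)]) ++ c) := by simpa using h
    have e1 := ih (b ++ [(k, a)]) (by simp) hbc
    have ha : a ∈ Algebra.adjoin ℂ {FreeAlgebra.ι ℂ k} := (h.2 (k, a) (by simp)).1
    have e3 : listProd ((k, a) :: c) = a * listProd c := by simp [listProd]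
    have e4 : listProd (b ++ [(k, a)]) = listProd b * a := by simp [listProd]
    rw [e4] at e1
    rw [e3, freeDiff_mul, mul_add, ← mul_assoc, Algebra.TensorProduct.tmul_mul_tmul, mul_one,
      ← map_mul, map_add, e1, zero_add]
    by_cases hk : k = i
    · subst hk
      refine Submodule.span_induction (p := fun t _ => tensorSq E
        ((FreeAlgebra.lift ℂ z (listProd b) ⊗ₜ 1) * (t *
          (1 ⊗ₜ FreeAlgebra.lift ℂ z (listProd c)))) = 0) ?_ ?_ ?_ ?_ (freeDiff_mem_span z k ha)
      · rintro _ ⟨p, hp, q, hq, rfl⟩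
        have := hf.map_mul_last h1 hbc.of_append_left hb hp
        rw [map_mul] at this
        simp [this]
      · simp
      · intro s t _ _ hs ht
        rw [add_mul, mul_add, map_add, hs, ht, add_zero]
      · intro r t _ ht
        rw [smul_mul_assoc, mul_smul_comm, map_smul, ht, smul_zero]
    · rw [freeDiff_eq_zero_of_mem_adjoin z hk ha, zero_mul, mul_zero, map_zero]

/-- With at least two letters, a derivative of a later letter dies through its left leg and a
derivative of the first letter through its right leg. -/
lemma ListFree.tensorSq_freeDiff [DecidableEq ι] (hf : ListFree E z) (h1 : E 1 = 1) (i k : ι)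
    (a : FreeAlgebra ℂ ι) (c : List (ι × FreeAlgebra ℂ ι)) (hc : c ≠ [])
    (h : IsAltCentered E z ((k, a) :: c)) :
    tensorSq E (freeDiff z i (listProd ((k, a) :: c))) = 0 := by
  have ha : a ∈ Algebra.adjoin ℂ {FreeAlgebra.ι ℂ k} := (h.2 (k, a) (by simp)).1
  have e3 : listProd ((k, a) :: c) = a * listProd c := by simp [listProd]
  have e1 := hf.tensorSq_mul_freeDiff h1 i c [(k, a)] (by simp) h
  have e4 : listProd [(k, a)] = a := by simp [listProd]
  rw [e4] at e1
  rw [e3, freeDiff_mul, map_add, e1, zero_add]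
  by_cases hk : k = i
  · subst hk
    refine Submodule.span_induction (p := fun t _ => tensorSq E
        (t * (1 ⊗ₜ FreeAlgebra.lift ℂ z (listProd c))) = 0) ?_ ?_ ?_ ?_ (freeDiff_mem_span z k ha)
    · rintro _ ⟨p, hp, q, hq, rfl⟩
      have := hf.map_head_mul h1 h hc hq
      rw [map_mul] at this
      simp [this]
    · simp
    · intro s t _ _ hs ht
      rw [add_mul, map_add, hs, ht, add_zero]
    · intro r t _ ht
      rw [smul_mul_assoc, map_smul, ht, smul_zero]
  · rw [freeDiff_eq_zero_of_mem_adjoin z hk ha, zero_mul, map_zero]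

lemma isAltCentered_cons_ι {i k : ι} (hi : E (z i) = 0) (hik : i ≠ k) {a : FreeAlgebra ℂ ι}
    {l : List (ι × FreeAlgebra ℂ ι)} (h : IsAltCentered E z ((k, a) :: l)) :
    IsAltCentered E z ((i, FreeAlgebra.ι ℂ i) :: (k, a) :: l) := by
  refine ⟨List.isChain_cons_cons.2 ⟨hik, h.1⟩, ?_⟩
  intro b hb
  rcases List.mem_cons.1 hb with rfl | hb
  · exact ⟨Algebra.subset_adjoin rfl, by simpa using hi⟩
  · exact h.2 b hb

/-- The span contains `1` and is a left ideal. A generator multiplied into a word either becomes a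
new centered letter, or merges with the head; the merged head is recentered, at the cost of a
multiple of the word without its head. -/
lemma span_listProd_eq_top (h1 : E 1 = 1) (h0 : ∀ i, E (z i) = 0) :
    Submodule.span ℂ {w | ∃ l, IsAltCentered E z l ∧ w = listProd l} = ⊤ := by
  set N := Submodule.span ℂ {w | ∃ l, IsAltCentered E z l ∧ w = listProd l} with hN
  have key : ∀ w : FreeAlgebra ℂ ι, ∀ n ∈ N, w * n ∈ N := by
    intro w
    induction w using FreeAlgebra.induction with
    | grade0 r =>
      intro n hn
      rw [← Algebra.smul_def]
      exact N.smul_mem r hn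
    | grade1 k =>
      intro n hn
      refine Submodule.span_induction (p := fun t _ => FreeAlgebra.ι ℂ k * t ∈ N) ?_ ?_ ?_ ?_ hn
      · rintro _ ⟨l, hl, rfl⟩
        rcases l with _ | ⟨⟨j, a⟩, l⟩
        · refine Submodule.subset_span ⟨[(k, FreeAlgebra.ι ℂ k)], ⟨by simp, ?_⟩, by simp [listProd]⟩
          intro b hb
          rw [List.mem_singleton] at hb
          subst hb
          exact ⟨Algebra.subset_adjoin rfl, by simpa using h0 k⟩
        · by_cases hjk : k = j
          · subst hjk
            have ha := (hl.2 (k, a) (by simp)).1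
            have hp : FreeAlgebra.ι ℂ k * a ∈ Algebra.adjoin ℂ {FreeAlgebra.ι ℂ k} :=
              mul_mem (Algebra.subset_adjoin rfl) ha
            have e : FreeAlgebra.ι ℂ k * listProd ((k, a) :: l) =
                listProd ((k, centering E z (FreeAlgebra.ι ℂ k * a)) :: l) +
                E (FreeAlgebra.lift ℂ z (FreeAlgebra.ι ℂ k * a)) • listProd l := by
              rw [Algebra.smul_def]
              simp only [listProd, List.map_cons, List.prod_cons, ← add_mul, ← eq_centering_add,
                mul_assoc]
            rw [e]
            refine add_mem (Submodule.subset_span ⟨_, ?_, rfl⟩)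
              (N.smul_mem _ (Submodule.subset_span ⟨l, hl.tail, rfl⟩))
            exact hl.replace_head (centering_mem hp) (map_centering h1 _)
          · exact Submodule.subset_span ⟨_, isAltCentered_cons_ι (h0 k) hjk hl, by simp [listProd]⟩
      · rw [mul_zero]; exact zero_mem _
      · intro s t _ _ hs ht
        rw [mul_add]; exact add_mem hs ht
      · intro r t _ ht
        rw [mul_smul_comm]; exact N.smul_mem _ ht
    | mul a b ha hb => intro n hn; rw [mul_assoc]; exact ha _ (hb _ hn)
    | add a b ha hb => intro n hn; rw [add_mul]; exact add_mem (ha _ hn) (hb _ hn)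
  have hone : (1 : FreeAlgebra ℂ ι) ∈ N :=
    Submodule.subset_span ⟨[], ⟨by simp, by simp⟩, by simp [listProd]⟩
  refine eq_top_iff.2 fun w _ => ?_
  simpa using key w 1 hone

/-- On powers of a single variable the equation is exactly the Catalan recursion for the moments. -/
lemma schwingerDyson_of_mem_adjoin [DecidableEq ι] {i : ι}
    (hcat : ∀ n : ℕ, E (z i ^ (n + 1)) =
      ∑ j ∈ Finset.range n, E (z i ^ j) * E (z i ^ (n - 1 - j)))
    {p : FreeAlgebra ℂ ι} (hp : p ∈ Algebra.adjoin ℂ {FreeAlgebra.ι ℂ i}) :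
    E (FreeAlgebra.lift ℂ z (FreeAlgebra.ι ℂ i * p)) = tensorSq E (freeDiff z i p) := by
  rw [Algebra.adjoin_singleton_eq_range_aeval] at hp
  obtain ⟨f, rfl⟩ := hp
  change E (FreeAlgebra.lift ℂ z (FreeAlgebra.ι ℂ i * Polynomial.aeval (FreeAlgebra.ι ℂ i) f))
    = tensorSq E (freeDiff z i (Polynomial.aeval (FreeAlgebra.ι ℂ i) f))
  induction f using Polynomial.induction_on' with
  | add f g hf hg => rw [map_add, mul_add, map_add, map_add, hf, hg, freeDiff_add, map_add]
  | monomial n c =>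
    rw [Polynomial.aeval_monomial, ← Algebra.smul_def, mul_smul_comm, map_smul, map_smul,
      freeDiff_smul, map_smul, ← pow_succ', freeDiff_pow]
    congr 1
    simp [freeDiff_ι, hcat]

/-- The Schwinger-Dyson equation for free semicircular variables. -/
theorem schwingerDyson [DecidableEq ι] (hf : ListFree E z) (h1 : E 1 = 1)
    (hcat : ∀ i, ∀ n : ℕ, E (z i ^ (n + 1)) =
      ∑ j ∈ Finset.range n, E (z i ^ j) * E (z i ^ (n - 1 - j)))
    (i : ι) (w : FreeAlgebra ℂ ι) :
    E (FreeAlgebra.lift ℂ z (FreeAlgebra.ι ℂ i * w)) = tensorSq E (freeDiff z i w) := by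
  have h0 : ∀ i, E (z i) = 0 := fun i => by simpa using hcat i 0
  have hw : w ∈ Submodule.span ℂ {w | ∃ l, IsAltCentered E z l ∧ w = listProd l} := by
    rw [span_listProd_eq_top h1 h0]; trivial
  induction hw using Submodule.span_induction with
  | zero => simp [freeDiff]
  | add s t _ _ hs ht => rw [mul_add, map_add, map_add, hs, ht, freeDiff_add, map_add]
  | smul c s _ hs => rw [mul_smul_comm, map_smul, map_smul, hs, freeDiff_smul, map_smul]
  | mem w hw =>
    obtain ⟨l, hl, rfl⟩ := hw
    rcases l with _ | ⟨⟨k, a⟩, l⟩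
    · simp [listProd, freeDiff_one, h0]
    · have ha := (hl.2 (k, a) (by simp)).1
      by_cases hik : i = k
      · subst hik
        rcases eq_or_ne l [] with rfl | hne
        · simpa [listProd] using schwingerDyson_of_mem_adjoin (hcat i) ha
        -- Both sides vanish: on the left, `z i` merges with the head, which need not be centered
        -- because further letters follow.
        · rw [hf.tensorSq_freeDiff h1 i i a l hne hl]
          have hi : FreeAlgebra.ι ℂ i ∈ Algebra.adjoin ℂ {FreeAlgebra.ι ℂ i} :=
            Algebra.subset_adjoin rfl
          have := hf.map_head_mul h1 hl hne (mul_mem hi ha)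
          simpa [listProd, mul_assoc] using this
      · have e := hf _ (isAltCentered_cons_ι (h0 i) hik hl) (by simp)
        have e' : E (FreeAlgebra.lift ℂ z (FreeAlgebra.ι ℂ i * listProd ((k, a) :: l))) = 0 := by
          simpa [listProd] using e
        rw [e']
        rcases eq_or_ne l [] with rfl | hne
        · simp [listProd, freeDiff_eq_zero_of_mem_adjoin z (Ne.symm hik) ha]
        · rw [hf.tensorSq_freeDiff h1 i k a l hne hl]

end FreeDifferenceQuotient

/-! ### The cubic equation for the moments of the anticommutator -/

section AnticommutatorMoments

lemma coeff_X_mul_mk_mul_mk {R : Type*} [CommRing R] (f g : ℕ → R) (n : ℕ) :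
    PowerSeries.coeff n (PowerSeries.X * (PowerSeries.mk f * PowerSeries.mk g)) =
      ∑ j ∈ Finset.range n, f j * g (n - 1 - j) := by
  rcases n with _ | n
  · simp
  · rw [PowerSeries.coeff_succ_X_mul, PowerSeries.coeff_mul,
      Finset.Nat.sum_antidiagonal_eq_sum_range_succ_mk]
    simp

/-- The cubic equation of the tetilla moment series has at most one formal solution. -/
lemma eq_of_cubic {K : Type*} [Field K] (c : K) {M N : PowerSeries K}
    (hM : M = 1 + PowerSeries.C c * PowerSeries.X ^ 2 * (M ^ 2 + M ^ 3))
    (hN : N = 1 + PowerSeries.C c * PowerSeries.X ^ 2 * (N ^ 2 + N ^ 3)) : M = N := by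
  -- The difference of the two equations factors through `M - N`; the cofactor has constant
  -- coefficient `1`, hence is nonzero.
  have h : (M - N) * (1 - PowerSeries.X * (PowerSeries.C c * PowerSeries.X *
      (M + N + M ^ 2 + M * N + N ^ 2))) = 0 := by
    linear_combination hM - hN
  rcases mul_eq_zero.1 h with h | h
  · exact sub_eq_zero.1 h
  · have := congrArg PowerSeries.constantCoeff h
    simp at this

variable {ι B : Type*} [Ring B] [Algebra ℂ B] {E : B →ₗ[ℂ] ℂ} {z : ι → B}

/-- The anticommutator of two variables, in the free algebra. -/
noncomputable def freeAnticomm (i j : ι) : FreeAlgebra ℂ ι :=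
  FreeAlgebra.ι ℂ i * FreeAlgebra.ι ℂ j + FreeAlgebra.ι ℂ j * FreeAlgebra.ι ℂ i

lemma lift_freeAnticomm (i j : ι) :
    FreeAlgebra.lift ℂ z (freeAnticomm i j) = z i * z j + z j * z i := by
  simp [freeAnticomm]

variable [DecidableEq ι]

lemma freeDiff_freeAnticomm {i j : ι} (hij : i ≠ j) :
    freeDiff z i (freeAnticomm i j) = 1 ⊗ₜ z j + z j ⊗ₜ 1 := by
  simp [freeAnticomm, freeDiff_add, freeDiff_mul, freeDiff_ι, hij.symm]

lemma freeDiff_freeAnticomm_pow {i j : ι} (hij : i ≠ j) (n : ℕ) {t : B}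
    (ht : t = z i * z j + z j * z i) :
    freeDiff z i (freeAnticomm i j ^ n) = ∑ k ∈ Finset.range n,
      ((t ^ k) ⊗ₜ[ℂ] (z j * t ^ (n - 1 - k)) + (t ^ k * z j) ⊗ₜ[ℂ] (t ^ (n - 1 - k))) := by
  rw [freeDiff_pow, lift_freeAnticomm, ← ht, freeDiff_freeAnticomm hij]
  simp [mul_add, add_mul]

/-- The Schwinger-Dyson equation for the functional `E` at the family `z`. -/
def SchwingerDyson (E : B →ₗ[ℂ] ℂ) (z : ι → B) : Prop :=
  ∀ i w, E (z i * FreeAlgebra.lift ℂ z w) = tensorSq E (freeDiff z i w)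

/-- Every term of `∂ᵢ (t ^ n)` has a leg that is, up to cyclic order, `z j * t ^ k` with `k < n`;
strong induction runs on both variables at once. In the next two lemmas this kills one of the two
halves of `∂ᵢ t`. -/
lemma SchwingerDyson.map_mul_anticomm_pow (h : SchwingerDyson E z)
    (htr : ∀ a b, E (a * b) = E (b * a)) {i j : ι} (hij : i ≠ j) {t : B}
    (ht : t = z i * z j + z j * z i) (n : ℕ) :
    E (z i * t ^ n) = 0 ∧ E (z j * t ^ n) = 0 := by
  have key : ∀ i j : ι, i ≠ j → t = z i * z j + z j * z i → ∀ n,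
      (∀ k < n, E (z j * t ^ k) = 0) → E (z i * t ^ n) = 0 := by
    intro i j hij ht n hn
    have e := h i (freeAnticomm i j ^ n)
    rw [map_pow, lift_freeAnticomm, ← ht, freeDiff_freeAnticomm_pow hij n ht, map_sum] at e
    rw [e]
    refine Finset.sum_eq_zero fun k hk => ?_
    have hk := Finset.mem_range.1 hk
    rw [map_add, tensorSq_tmul, tensorSq_tmul, hn _ (by omega), htr (t ^ k), hn _ hk]
    simp
  induction n using Nat.strong_induction_on with
  | _ n ih =>
    exact ⟨key i j hij ht n fun k hk => (ih k hk).2,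
      key j i hij.symm (by rw [ht, add_comm]) n fun k hk => (ih k hk).1⟩

/-- The equation is applied to the first `z i`: the last `z i` contributes `t ^ n ⊗ 1`, and in each
factor `t` only the half with `z j` in the right leg survives, which the trace then rotates. -/
lemma SchwingerDyson.map_sandwich (h : SchwingerDyson E z) (h1 : E 1 = 1)
    (htr : ∀ a b, E (a * b) = E (b * a)) {i j : ι} (hij : i ≠ j) {t : B}
    (ht : t = z i * z j + z j * z i) (n : ℕ) :
    E (z i * t ^ n * z i) = E (t ^ n) +
      ∑ k ∈ Finset.range n, E (t ^ k) * E (z i * z j * t ^ (n - 1 - k)) := by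
  have e := h i (freeAnticomm i j ^ n * FreeAlgebra.ι ℂ i)
  rw [freeDiff_mul, map_mul (FreeAlgebra.lift ℂ z), map_pow, lift_freeAnticomm, ← ht,
    freeDiff_freeAnticomm_pow hij n ht, freeDiff_ι, if_pos rfl, FreeAlgebra.lift_ι_apply,
    mul_one, map_add, tensorSq_tmul, h1, mul_one, Finset.sum_mul, map_sum, ← mul_assoc] at e
  rw [e]
  congr 1
  refine Finset.sum_congr rfl fun k _ => ?_
  rw [add_mul, Algebra.TensorProduct.tmul_mul_tmul, Algebra.TensorProduct.tmul_mul_tmul, map_add,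
    tensorSq_tmul, tensorSq_tmul, mul_one, mul_one, htr (t ^ k) (z j),
    (h.map_mul_anticomm_pow htr hij ht k).2, zero_mul, add_zero, htr (z j * _), ← mul_assoc]

/-- Here the surviving half has left leg `z j * t ^ k * z j`, which closes the system of recursions.
-/
lemma SchwingerDyson.map_mul_mul_anticomm_pow (h : SchwingerDyson E z)
    (htr : ∀ a b, E (a * b) = E (b * a)) {i j : ι} (hij : i ≠ j) {t : B}
    (ht : t = z i * z j + z j * z i) (n : ℕ) :
    E (z i * z j * t ^ n) =
      ∑ k ∈ Finset.range n, E (z j * t ^ k * z j) * E (t ^ (n - 1 - k)) := by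
  have e := h i (FreeAlgebra.ι ℂ j * freeAnticomm i j ^ n)
  rw [freeDiff_mul, map_mul (FreeAlgebra.lift ℂ z), map_pow, lift_freeAnticomm, ← ht,
    freeDiff_freeAnticomm_pow hij n ht, freeDiff_ι, if_neg hij.symm, FreeAlgebra.lift_ι_apply,
    zero_mul, add_zero, Finset.mul_sum, map_sum, ← mul_assoc] at e
  rw [e]
  refine Finset.sum_congr rfl fun k _ => ?_
  rw [mul_add, Algebra.TensorProduct.tmul_mul_tmul, Algebra.TensorProduct.tmul_mul_tmul, map_add,
    tensorSq_tmul, tensorSq_tmul, one_mul, one_mul, (h.map_mul_anticomm_pow htr hij ht k).2,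
    zero_mul, zero_add, mul_assoc]

/-- The moment series of the anticommutator of two variables satisfying the Schwinger-Dyson
equations solves a cubic equation. -/
theorem SchwingerDyson.cubic (h : SchwingerDyson E z) (h1 : E 1 = 1)
    (htr : ∀ a b, E (a * b) = E (b * a)) {i j : ι} (hij : i ≠ j) {t : B}
    (ht : t = z i * z j + z j * z i) {M : PowerSeries ℂ}
    (hM : M = PowerSeries.mk fun n => E (t ^ n)) :
    M = 1 + PowerSeries.X ^ 2 * (M ^ 2 + M ^ 3) := by
  have ht' : t = z j * z i + z i * z j := by rw [ht, add_comm]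
  set R := PowerSeries.mk fun n => E (z i * z j * t ^ n) with hR
  set S := PowerSeries.mk fun n => E (z j * z i * t ^ n) with hS
  set U := PowerSeries.mk fun n => E (z i * t ^ n * z i) with hU
  set V := PowerSeries.mk fun n => E (z j * t ^ n * z j) with hV
  have eU : U = M + PowerSeries.X * (M * R) := by
    ext n
    rw [map_add, hM, hR, coeff_X_mul_mk_mul_mk, hU, PowerSeries.coeff_mk, PowerSeries.coeff_mk]
    exact h.map_sandwich h1 htr hij ht n
  have eV : V = M + PowerSeries.X * (M * S) := by
    ext n
    rw [map_add, hM, hS, coeff_X_mul_mk_mul_mk, hV, PowerSeries.coeff_mk, PowerSeries.coeff_mk]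
    exact h.map_sandwich h1 htr hij.symm ht' n
  have eR : R = PowerSeries.X * (V * M) := by
    ext n
    rw [hM, hV, coeff_X_mul_mk_mul_mk, hR, PowerSeries.coeff_mk]
    exact h.map_mul_mul_anticomm_pow htr hij ht n
  have eS : S = PowerSeries.X * (U * M) := by
    ext n
    rw [hM, hU, coeff_X_mul_mk_mul_mk, hS, PowerSeries.coeff_mk]
    exact h.map_mul_mul_anticomm_pow htr hij.symm ht' n
  have eM : M = 1 + PowerSeries.X * (R + S) := by
    ext n
    rcases n with _ | n
    · simp [hM, h1]
    · rw [hM, map_add, PowerSeries.coeff_succ_X_mul, map_add, hR, hS]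
      simp only [PowerSeries.coeff_mk, PowerSeries.coeff_one]
      rw [← map_add, ← add_mul, ← ht, pow_succ']
      simp
  -- The system is symmetric under exchange of the two variables, and `R - S` is annihilated by `1 +
  -- X² M²`, which is nonzero.
  have hRS : R = S := by
    have e : (R - S) * (1 + PowerSeries.X * (PowerSeries.X * M ^ 2)) = 0 := by
      linear_combination eR - eS + PowerSeries.X * M * eV - PowerSeries.X * M * eU
    rcases mul_eq_zero.1 e with e | e
    · exact sub_eq_zero.1 e
    · have := congrArg PowerSeries.constantCoeff e
      simp at this
  rw [← hRS] at eM eV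
  linear_combination (1 - PowerSeries.X ^ 2 * M ^ 2) * eM + 2 * PowerSeries.X * eR
    + 2 * PowerSeries.X ^ 2 * M * eV

end AnticommutatorMoments

/-! ### Catalan recursion for the semicircular moments -/

section SemicircularMoments

lemma integral_semicircularLaw_one (f : ℝ → ℝ) :
    ∫ t, f t ∂(semicircularLaw 1) =
      1 / (2 * Real.pi) * ∫ u in (-2 : ℝ)..2, f u * √(4 - u ^ 2) := by
  have hm : Measurable fun u : ℝ => (Set.Ioo (-(2 * √1)) (2 * √1)).indicator
      (fun u => 1 / (2 * Real.pi * 1) * √(4 * 1 - u ^ 2)) u := by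
    refine Measurable.indicator ?_ measurableSet_Ioo
    fun_prop
  rw [semicircularLaw, integral_withDensity_eq_integral_toReal_smul
    hm.ennreal_ofReal (by simp), intervalIntegral.integral_of_le (by norm_num),
    integral_Ioc_eq_integral_Ioo, ← integral_const_mul,
    ← integral_indicator measurableSet_Ioo]
  refine integral_congr_ae (Filter.Eventually.of_forall fun u => ?_)
  simp only [Real.sqrt_one, mul_one, Set.indicator]
  split_ifs with h
  · rw [ENNReal.toReal_ofReal (by positivity), smul_eq_mul]
    ring
  · simp

/-- The integrand is the derivative of `u ^ k (4 - u²)^(3/2)`, which vanishes at `±2`. This yields a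
two-step recursion for the moments, matching the ratio of consecutive Catalan numbers. -/
lemma integral_deriv_pow_mul_semicircle (k : ℕ) :
    ∫ u in (-2 : ℝ)..2, (k * u ^ (k - 1) * (4 - u ^ 2) - 3 * u ^ (k + 1)) * √(4 - u ^ 2) = 0 := by
  rw [intervalIntegral.integral_eq_sub_of_hasDerivAt_of_le (by norm_num)
    (f := fun u : ℝ => u ^ k * ((4 - u ^ 2) * √(4 - u ^ 2)))]
  · norm_num
  · fun_prop
  · rintro u ⟨h1, h2⟩
    have hpos : 0 < 4 - u ^ 2 := by nlinarith
    have hd : HasDerivAt (fun u : ℝ => 4 - u ^ 2) (-(2 * u)) u := by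
      simpa using (hasDerivAt_pow 2 u).const_sub 4
    have hs := hd.sqrt hpos.ne'
    have := (hasDerivAt_pow k u).mul (hd.mul hs)
    refine this.congr_deriv ?_
    have hne : √(4 - u ^ 2) ≠ 0 := (Real.sqrt_pos.2 hpos).ne'
    have hsq : √(4 - u ^ 2) ^ 2 = 4 - u ^ 2 := Real.sq_sqrt hpos.le
    simp only [Pi.mul_apply]
    field_simp
    rw [hsq]
    ring
  · apply Continuous.intervalIntegrable
    fun_prop

/-- The moments of the standard semicircular law. -/
noncomputable def semicircularMoment (n : ℕ) : ℝ := ∫ t, t ^ n ∂(semicircularLaw 1)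

lemma semicircularMoment_one : semicircularMoment 1 = 0 := by
  have h := integral_deriv_pow_mul_semicircle 0
  rw [semicircularMoment, integral_semicircularLaw_one]
  simp only [CharP.cast_eq_zero, zero_mul, zero_sub, zero_add, neg_mul, mul_assoc,
    intervalIntegral.integral_neg, intervalIntegral.integral_const_mul] at h
  rw [show (∫ u in (-2 : ℝ)..2, u ^ 1 * √(4 - u ^ 2)) = 0 by linarith, mul_zero]

lemma semicircularMoment_add_two (n : ℕ) :
    (n + 4) * semicircularMoment (n + 2) = 4 * (n + 1) * semicircularMoment n := by
  have h := integral_deriv_pow_mul_semicircle (n + 1)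
  have e : ∀ u : ℝ, ((↑(n + 1) : ℝ) * u ^ (n + 1 - 1) * (4 - u ^ 2) - 3 * u ^ (n + 1 + 1)) *
      √(4 - u ^ 2) = 4 * (n + 1) * (u ^ n * √(4 - u ^ 2)) -
        (n + 4) * (u ^ (n + 2) * √(4 - u ^ 2)) := by
    intro u
    push_cast
    ring
  simp only [e] at h
  have hi : ∀ (c : ℝ) (m : ℕ), IntervalIntegrable (fun u : ℝ => c * (u ^ m * √(4 - u ^ 2)))
      volume (-2) 2 := fun c m => Continuous.intervalIntegrable (by fun_prop) _ _
  rw [intervalIntegral.integral_sub (hi _ _) (hi _ _), intervalIntegral.integral_const_mul,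
    intervalIntegral.integral_const_mul] at h
  rw [semicircularMoment, semicircularMoment, integral_semicircularLaw_one,
    integral_semicircularLaw_one]
  linear_combination -(1 / (2 * Real.pi)) * h

lemma semicircularMoment_odd (k : ℕ) : semicircularMoment (2 * k + 1) = 0 := by
  induction k with
  | zero => exact semicircularMoment_one
  | succ k ih =>
    have h := semicircularMoment_add_two (2 * k + 1)
    rw [ih, mul_zero] at h
    exact (mul_eq_zero.1 h).resolve_left (by positivity)

lemma succ_succ_mul_catalan_succ (k : ℕ) :
    (k + 2) * catalan (k + 1) = 2 * (2 * k + 1) * catalan k := by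
  have h1 := succ_mul_catalan_eq_centralBinom (k + 1)
  have h2 := succ_mul_catalan_eq_centralBinom k
  have h3 := Nat.succ_mul_centralBinom_succ k
  rw [← h1, ← h2] at h3
  have : (k + 1) * ((k + 2) * catalan (k + 1)) = (k + 1) * (2 * (2 * k + 1) * catalan k) := by
    linarith
  exact Nat.eq_of_mul_eq_mul_left (Nat.succ_pos k) this

lemma semicircularMoment_even (h0 : semicircularMoment 0 = 1) (k : ℕ) :
    semicircularMoment (2 * k) = catalan k := by
  induction k with
  | zero => simpa using h0
  | succ k ih =>
    have h := semicircularMoment_add_two (2 * k)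
    have hc : ((k : ℝ) + 2) * catalan (k + 1) = 2 * (2 * k + 1) * catalan k := by
      exact_mod_cast succ_succ_mul_catalan_succ k
    rw [ih] at h
    push_cast at h
    have hk : ((k : ℝ) + 2) ≠ 0 := by positivity
    refine mul_left_cancel₀ hk ?_
    rw [hc, show 2 * (k + 1) = 2 * k + 2 by ring]
    linarith

lemma sum_range_odd_eq_sum_even {f : ℕ → ℝ} (hf : ∀ k, f (2 * k + 1) = 0) (k : ℕ) :
    ∑ j ∈ Finset.range (2 * k + 1), f j = ∑ i ∈ Finset.range (k + 1), f (2 * i) := by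
  induction k with
  | zero => simp
  | succ k ih =>
    rw [show 2 * (k + 1) + 1 = 2 * k + 1 + 1 + 1 by ring, Finset.sum_range_succ,
      Finset.sum_range_succ, ih, hf, Finset.sum_range_succ _ (k + 1)]
    simp [mul_add]

/-- For even `n` both sides vanish by parity. For odd `n` only even indices contribute, and the sum
is the Catalan convolution. -/
lemma semicircularMoment_succ (h0 : semicircularMoment 0 = 1) (n : ℕ) :
    semicircularMoment (n + 1) =
      ∑ j ∈ Finset.range n, semicircularMoment j * semicircularMoment (n - 1 - j) := by
  rcases Nat.even_or_odd' n with ⟨k, rfl | rfl⟩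
  · rw [semicircularMoment_odd]
    refine (Finset.sum_eq_zero fun j hj => ?_).symm
    have hj := Finset.mem_range.1 hj
    rcases Nat.even_or_odd' j with ⟨i, rfl | rfl⟩
    · rw [show 2 * k - 1 - 2 * i = 2 * (k - 1 - i) + 1 by omega, semicircularMoment_odd, mul_zero]
    · rw [semicircularMoment_odd, zero_mul]
  · rw [sum_range_odd_eq_sum_even fun i => by rw [semicircularMoment_odd, zero_mul],
      show 2 * k + 1 + 1 = 2 * (k + 1) by ring, semicircularMoment_even h0, catalan_succ']
    rw [Finset.Nat.sum_antidiagonal_eq_sum_range_succ_mk]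
    push_cast [Nat.add_sub_cancel]
    refine Finset.sum_congr rfl fun i hi => ?_
    have hi := Finset.mem_range.1 hi
    rw [show 2 * k - 2 * i = 2 * (k - i) by omega, semicircularMoment_even h0,
      semicircularMoment_even h0]

end SemicircularMoments

/-! ### A continuous form of the density and its parametrisation -/

section ContinuousDensity

/-- The radicand of the tetilla density, divided by `t ^ 2`. -/
noncomputable def tetillaRad (t : ℝ) : ℝ := 6 + 132 * t ^ 2 - 24 * t ^ 4

/-- The larger cube root in the tetilla density. -/
noncomputable def tetillaRootPos (t : ℝ) : ℝ :=
  (1 + 36 * t ^ 2 + 3 * (|t| * √(tetillaRad t))) ^ (1 / 3 : ℝ)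

/-- The smaller cube root in the tetilla density. -/
noncomputable def tetillaRootNeg (t : ℝ) : ℝ :=
  (1 + 36 * t ^ 2 - 3 * (|t| * √(tetillaRad t))) ^ (1 / 3 : ℝ)

/-- The tetilla density, in a form that is continuous at `0`. -/
noncomputable def tetillaCont (t : ℝ) : ℝ :=
  √3 * √(tetillaRad t) / (Real.pi *
    (tetillaRootPos t ^ 2 + tetillaRootPos t * tetillaRootNeg t + tetillaRootNeg t ^ 2))

lemma sqrt_tetilla_radicand (t : ℝ) :
    √(6 * t ^ 2 + 132 * t ^ 4 - 24 * t ^ 6) = |t| * √(tetillaRad t) := by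
  rw [← Real.sqrt_sq_eq_abs, ← Real.sqrt_mul (sq_nonneg t), tetillaRad]
  congr 1
  ring

/-- The roots of `tetillaRad` in `t²` are `(11 ± 5√5)/4`, and only one is positive. Since `√` is `0`
on negative numbers, `tetillaCont` needs no indicator. -/
lemma tetillaRad_nonneg_iff (t : ℝ) :
    0 ≤ tetillaRad t ↔ t ∈ Set.Icc (-(√(11 + 5 * √5) / 2)) (√(11 + 5 * √5) / 2) := by
  have h5 : √5 ^ 2 = 5 := Real.sq_sqrt (by norm_num)
  have h5' : 2 < √5 := by
    rw [Real.lt_sqrt] <;> norm_num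
  have hb : (√(11 + 5 * √5) / 2) ^ 2 = (11 + 5 * √5) / 4 := by
    rw [div_pow, Real.sq_sqrt (by positivity)]
    norm_num
  have hf : tetillaRad t =
      24 * ((11 + 5 * √5) / 4 - t ^ 2) * (t ^ 2 + (5 * √5 - 11) / 4) := by
    rw [tetillaRad]
    linear_combination (24 * 25 / 16 : ℝ) * (-h5)
  have hpos : 0 < t ^ 2 + (5 * √5 - 11) / 4 := by
    have : 11 < 5 * √5 := by nlinarith
    positivity
  rw [Set.mem_Icc, ← abs_le, ← abs_of_nonneg (show 0 ≤ √(11 + 5 * √5) / 2 by positivity),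
    ← sq_le_sq, hb, hf]
  constructor
  · intro h
    have := nonneg_of_mul_nonneg_left h hpos
    linarith
  · intro h
    exact mul_nonneg (by linarith) hpos.le

/-- The two radicands multiply to `(1 + 6 t²)³` where the inner root is real, and the larger one is
positive. -/
lemma tetilla_smaller_cube_pos (t : ℝ) : 0 < 1 + 36 * t ^ 2 - 3 * (|t| * √(tetillaRad t)) := by
  rcases le_total 0 (tetillaRad t) with h | h
  · have hs : (|t| * √(tetillaRad t)) ^ 2 = t ^ 2 * tetillaRad t := by
      rw [mul_pow, sq_abs, Real.sq_sqrt h]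
    have h0 : 0 ≤ |t| * √(tetillaRad t) := by positivity
    have : 0 < (1 + 36 * t ^ 2 - 3 * (|t| * √(tetillaRad t))) *
        (1 + 36 * t ^ 2 + 3 * (|t| * √(tetillaRad t))) := by
      have e : (1 + 36 * t ^ 2 - 3 * (|t| * √(tetillaRad t))) *
        (1 + 36 * t ^ 2 + 3 * (|t| * √(tetillaRad t))) = (1 + 6 * t ^ 2) ^ 3 := by
        rw [tetillaRad] at hs ⊢
        linear_combination -9 * hs
      rw [e]
      positivity
    exact pos_of_mul_pos_left this (by positivity)
  · rw [Real.sqrt_eq_zero_of_nonpos h]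
    nlinarith [sq_nonneg t]

lemma tetillaRootPos_pos (t : ℝ) : 0 < tetillaRootPos t :=
  Real.rpow_pos_of_pos (by positivity) _

lemma tetillaRootNeg_pos (t : ℝ) : 0 < tetillaRootNeg t :=
  Real.rpow_pos_of_pos (tetilla_smaller_cube_pos t) _

lemma tetillaRootPos_cube (t : ℝ) :
    tetillaRootPos t ^ 3 = 1 + 36 * t ^ 2 + 3 * (|t| * √(tetillaRad t)) := by
  rw [tetillaRootPos, ← Real.rpow_natCast, ← Real.rpow_mul (by positivity)]
  norm_num

lemma tetillaRootNeg_cube (t : ℝ) :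
    tetillaRootNeg t ^ 3 = 1 + 36 * t ^ 2 - 3 * (|t| * √(tetillaRad t)) := by
  rw [tetillaRootNeg, ← Real.rpow_natCast, ← Real.rpow_mul (tetilla_smaller_cube_pos t).le]
  norm_num

lemma tetillaCont_denom_pos (t : ℝ) :
    0 < tetillaRootPos t ^ 2 + tetillaRootPos t * tetillaRootNeg t + tetillaRootNeg t ^ 2 := by
  have := tetillaRootPos_pos t
  have := tetillaRootNeg_pos t
  positivity

lemma continuous_tetillaCont : Continuous tetillaCont := by
  have h1 : Continuous tetillaRad := by unfold tetillaRad; fun_prop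
  have h2 : Continuous tetillaRootPos := by
    refine Continuous.rpow_const (by fun_prop) fun _ => Or.inr (by norm_num)
  have h3 : Continuous tetillaRootNeg := by
    refine Continuous.rpow_const (by fun_prop) fun _ => Or.inr (by norm_num)
  unfold tetillaCont
  refine Continuous.div (by fun_prop) (by fun_prop) fun t => ?_
  exact (mul_pos Real.pi_pos (tetillaCont_denom_pos t)).ne'

lemma tetillaCont_nonneg (t : ℝ) : 0 ≤ tetillaCont t := by
  have := tetillaCont_denom_pos t
  unfold tetillaCont
  positivity

lemma tetillaCont_eq_zero {t : ℝ}
    (ht : t ∉ Set.Icc (-(√(11 + 5 * √5) / 2)) (√(11 + 5 * √5) / 2)) : tetillaCont t = 0 := by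
  rw [← tetillaRad_nonneg_iff, not_le] at ht
  rw [tetillaCont, Real.sqrt_eq_zero_of_nonpos ht.le]
  simp

lemma tetillaDensity_zero : tetillaDensity 0 = 0 := by
  simp [tetillaDensity, Set.indicator]

/-- The difference of cube roots is rationalised by `U³ - V³ = (U - V)(U² + UV + V²)`, where `U³ -
V³ = 6 |t| √(tetillaRad t)` cancels the factor `1/|t|`. -/
lemma tetillaDensity_eq_tetillaCont {t : ℝ} (h0 : t ≠ 0) : tetillaDensity t = tetillaCont t := by
  rw [tetillaDensity, Set.indicator]
  split_ifs with ht
  · rw [sqrt_tetilla_radicand]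
    change 1 / (2 * √3 * Real.pi * |t|) * (tetillaRootPos t - tetillaRootNeg t) = _
    have hd := tetillaCont_denom_pos t
    have h3 : √3 ^ 2 = 3 := Real.sq_sqrt (by norm_num)
    have ht0 : |t| ≠ 0 := abs_ne_zero.2 h0
    have hs3 : √3 ≠ 0 := by positivity
    rw [tetillaCont, div_mul_eq_mul_div, one_mul, div_eq_div_iff (by positivity)
      (mul_pos Real.pi_pos hd).ne']
    have e1 := tetillaRootPos_cube t
    have e2 := tetillaRootNeg_cube t
    linear_combination Real.pi * e1 - Real.pi * e2 - 2 * Real.pi * |t| * √(tetillaRad t) * h3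
  · exact (tetillaCont_eq_zero ht).symm

lemma tetillaDensity_nonneg (t : ℝ) : 0 ≤ tetillaDensity t := by
  rcases eq_or_ne t 0 with rfl | h
  · rw [tetillaDensity_zero]
  · rw [tetillaDensity_eq_tetillaCont h]
    exact tetillaCont_nonneg t

lemma tetillaDensity_ae_eq : tetillaDensity =ᵐ[volume] tetillaCont := by
  have : ∀ᵐ t : ℝ ∂volume, t ≠ 0 := by simp [ae_iff]
  filter_upwards [this] with t ht using tetillaDensity_eq_tetillaCont ht

lemma measurable_tetillaDensity : Measurable tetillaDensity := by
  unfold tetillaDensity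
  refine Measurable.indicator ?_ measurableSet_Icc
  fun_prop

lemma hasCompactSupport_tetillaDensity : HasCompactSupport tetillaDensity := by
  refine HasCompactSupport.intro (K := Set.Icc (-(√(11 + 5 * √5) / 2)) (√(11 + 5 * √5) / 2))
    isCompact_Icc fun t ht => ?_
  rw [tetillaDensity, Set.indicator_of_notMem ht]

/-- Along the curve on which `t` is real, parametrised by `ρ = |G| ^ 2`, the density is
`Im G / π`. -/
lemma tetillaCont_eq_of_param {ρ t q : ℝ} (hρ : 0 < ρ) (hρ2 : ρ ≤ 2) (hq : 0 ≤ q)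
    (ht : t ^ 2 * (ρ ^ 2 * (2 + ρ)) = 2 * (2 - ρ)) (hq2 : 8 * q ^ 2 = ρ ^ 2 + 8 * ρ - 4) :
    tetillaCont t = q / Real.pi := by
  have h3 : √3 ^ 2 = 3 := Real.sq_sqrt (by norm_num)
  have ht' : t ^ 2 = 2 * (2 - ρ) / (ρ ^ 2 * (2 + ρ)) := by
    rw [eq_div_iff (by positivity), ht]
  have hq2' : q ^ 2 = (ρ ^ 2 + 8 * ρ - 4) / 8 := by linarith
  -- For `G` on the curve, `A = 1 + 3 t Re G` and `q = Im G`. Cardano's formula for `t G³ + G² - 2 t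
  -- G + 2 = 0` then predicts the cube roots `A ± √3 |t| q`, which is verified by cubing.
  obtain ⟨A, hA⟩ : ∃ A, A = (6 - ρ) / (2 * ρ) := ⟨_, rfl⟩
  have hA0 : 0 < A := by
    rw [hA]
    exact div_pos (by linarith) (by linarith)
  have hw : 0 < A ^ 2 + t ^ 2 * q ^ 2 := by positivity
  have hrad : tetillaRad t = (√3 * q * (A ^ 2 + t ^ 2 * q ^ 2)) ^ 2 := by
    rw [mul_pow, mul_pow, h3, tetillaRad, show t ^ 4 = (t ^ 2) ^ 2 by ring, ht', hq2', hA]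
    field_simp
    ring
  have hsqrt : √(tetillaRad t) = √3 * q * (A ^ 2 + t ^ 2 * q ^ 2) := by
    rw [hrad, Real.sqrt_sq (by positivity)]
  have hD : 1 + 36 * t ^ 2 = A ^ 3 + 9 * A * (t ^ 2 * q ^ 2) := by
    rw [ht', hq2', hA]
    field_simp
    ring
  have hC : A ^ 2 - 3 * (t ^ 2 * q ^ 2) = 1 + 6 * t ^ 2 := by
    rw [ht', hq2', hA]
    field_simp
    ring
  have hs : |t| ^ 2 = t ^ 2 := sq_abs t
  have hu0 : 0 < A + √3 * (|t| * q) := by positivity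
  have hv0 : 0 < A - √3 * (|t| * q) := by
    have : 0 < (A - √3 * (|t| * q)) * (A + √3 * (|t| * q)) := by
      have e : (A - √3 * (|t| * q)) * (A + √3 * (|t| * q)) = 1 + 6 * t ^ 2 := by
        rw [← hC, ← hs]
        linear_combination -(|t| ^ 2 * q ^ 2) * h3
      rw [e]
      positivity
    exact pos_of_mul_pos_left this hu0.le
  have hU : tetillaRootPos t = A + √3 * (|t| * q) := by
    have e : 1 + 36 * t ^ 2 + 3 * (|t| * √(tetillaRad t)) = (A + √3 * (|t| * q)) ^ 3 := by
      rw [hD, hsqrt, ← hs]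
      linear_combination -(3 * A * |t| ^ 2 * q ^ 2 + √3 * |t| ^ 3 * q ^ 3) * h3
    rw [tetillaRootPos, e, ← Real.rpow_natCast, ← Real.rpow_mul hu0.le]
    norm_num
  have hV : tetillaRootNeg t = A - √3 * (|t| * q) := by
    have e : 1 + 36 * t ^ 2 - 3 * (|t| * √(tetillaRad t)) = (A - √3 * (|t| * q)) ^ 3 := by
      rw [hD, hsqrt, ← hs]
      linear_combination -(3 * A * |t| ^ 2 * q ^ 2 - √3 * |t| ^ 3 * q ^ 3) * h3
    rw [tetillaRootNeg, e, ← Real.rpow_natCast, ← Real.rpow_mul hv0.le]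
    norm_num
  have hden : tetillaRootPos t ^ 2 + tetillaRootPos t * tetillaRootNeg t + tetillaRootNeg t ^ 2
      = 3 * (A ^ 2 + t ^ 2 * q ^ 2) := by
    rw [hU, hV, ← hs]
    linear_combination (|t| ^ 2 * q ^ 2) * h3
  rw [tetillaCont, hden, hsqrt]
  have := Real.pi_pos
  rw [div_eq_div_iff (by positivity) (by positivity)]
  linear_combination (q * (A ^ 2 + t ^ 2 * q ^ 2) * Real.pi) * h3

end ContinuousDensity

/-! ### Winding of paths in the upper half-plane around real points -/

section LogarithmicIntegrals

/-- The argument of `G - a` does not change along a path in the upper half-plane between points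
on the same side of `a`, the real point `a` being to the right. -/
lemma im_integral_inv_sub_of_lt {G G' : ℝ → ℂ} {r a T : ℝ} (hT : 0 ≤ T)
    (hG : ∀ θ, HasDerivAt G (G' θ) θ)
    (hG' : Continuous G') (h0 : G 0 = r) (h1 : G T = -r)
    (him : ∀ θ ∈ Set.Icc 0 T, G θ = r ∨ G θ = -r ∨ 0 < (G θ).im) (hr : 0 < r) (ha : r < a) :
    (∫ θ in (0 : ℝ)..T, G' θ / (G θ - a)).im = 0 := by
  have hcont : Continuous G := continuous_iff_continuousAt.2 fun θ => (hG θ).continuousAt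
  -- `a - G` lies in the lower half-plane or is a positive real, so the principal logarithm is a
  -- primitive along the whole path.
  have hs : ∀ θ ∈ Set.Icc 0 T, (a - G θ : ℂ) ∈ Complex.slitPlane := by
    intro θ hθ
    rw [Complex.mem_slitPlane_iff]
    rcases him θ hθ with h | h | h
    · left; rw [h]; simp [ha]
    · left; rw [h]; simp; linarith
    · right; simp [h.ne']
  have hne : ∀ θ ∈ Set.Icc 0 T, (G θ - a : ℂ) ≠ 0 := fun θ hθ h =>
    Complex.slitPlane_ne_zero (hs θ hθ) (by linear_combination -h)
  rw [intervalIntegral.integral_eq_sub_of_hasDerivAt (f := fun θ => Complex.log (a - G θ))]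
  · rw [h0, h1, ← Complex.ofReal_sub, ← Complex.ofReal_neg, ← Complex.ofReal_sub,
      ← Complex.ofReal_log (by linarith), ← Complex.ofReal_log (by linarith)]
    simp
  · intro θ hθ
    rw [Set.uIcc_of_le hT] at hθ
    refine (((hG θ).const_sub (a : ℂ)).clog_real (hs θ hθ)).congr_deriv ?_
    rw [← neg_sub (G θ), neg_div_neg_eq]
  · refine ContinuousOn.intervalIntegrable ?_
    rw [Set.uIcc_of_le hT]
    exact ContinuousOn.div hG'.continuousOn (by fun_prop) hne

/-- The argument of `G - a` does not change along a path in the upper half-plane between points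
on the same side of `a`, the real point `a` being to the left. -/
lemma im_integral_inv_sub_of_gt {G G' : ℝ → ℂ} {r a T : ℝ} (hT : 0 ≤ T)
    (hG : ∀ θ, HasDerivAt G (G' θ) θ)
    (hG' : Continuous G') (h0 : G 0 = r) (h1 : G T = -r)
    (him : ∀ θ ∈ Set.Icc 0 T, G θ = r ∨ G θ = -r ∨ 0 < (G θ).im) (hr : 0 < r) (ha : a < -r) :
    (∫ θ in (0 : ℝ)..T, G' θ / (G θ - a)).im = 0 := by
  have hcont : Continuous G := continuous_iff_continuousAt.2 fun θ => (hG θ).continuousAt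
  have hs : ∀ θ ∈ Set.Icc 0 T, (G θ - a : ℂ) ∈ Complex.slitPlane := by
    intro θ hθ
    rw [Complex.mem_slitPlane_iff]
    rcases him θ hθ with h | h | h
    · left; rw [h]; simp; linarith
    · left; rw [h]; simp; linarith
    · right; simp [h.ne']
  rw [intervalIntegral.integral_eq_sub_of_hasDerivAt (f := fun θ => Complex.log (G θ - a))]
  · rw [h0, h1, ← Complex.ofReal_sub, ← Complex.ofReal_neg, ← Complex.ofReal_sub,
      ← Complex.ofReal_log (by linarith), ← Complex.ofReal_log (by linarith)]
    simp
  · intro θ hθ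
    rw [Set.uIcc_of_le hT] at hθ
    exact ((hG θ).sub_const (a : ℂ)).clog_real (hs θ hθ)
  · refine ContinuousOn.intervalIntegrable ?_
    rw [Set.uIcc_of_le hT]
    exact ContinuousOn.div hG'.continuousOn (by fun_prop)
      fun θ hθ => Complex.slitPlane_ne_zero (hs θ hθ)

/-- The argument of `G - a` increases by `π` along a path in the upper half-plane from the right of
the real point `a` to its left. -/
lemma im_integral_inv_sub_of_mem {G G' : ℝ → ℂ} {r a T : ℝ} (hT : 0 ≤ T)
    (hG : ∀ θ, HasDerivAt G (G' θ) θ)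
    (hG' : Continuous G') (h0 : G 0 = r) (h1 : G T = -r)
    (him : ∀ θ ∈ Set.Icc 0 T, G θ = r ∨ G θ = -r ∨ 0 < (G θ).im) (ha : |a| < r) :
    (∫ θ in (0 : ℝ)..T, G' θ / (G θ - a)).im = Real.pi := by
  obtain ⟨ha1, ha2⟩ := abs_lt.1 ha
  have hcont : Continuous G := continuous_iff_continuousAt.2 fun θ => (hG θ).continuousAt
  -- Multiplying by `-I` turns the upper half-plane into the right half-plane, away from the cut;
  -- the endpoint arguments become `-π/2` and `π/2`.
  have hs : ∀ θ ∈ Set.Icc 0 T, (-Complex.I * (G θ - a) : ℂ) ∈ Complex.slitPlane := by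
    intro θ hθ
    rw [Complex.mem_slitPlane_iff]
    rcases him θ hθ with h | h | h
    · right; rw [h]; simp; intro h; linarith
    · right; rw [h]; simp; intro h; linarith
    · left; simp [h]
  have hne : ∀ θ ∈ Set.Icc 0 T, (G θ - a : ℂ) ≠ 0 := fun θ hθ h =>
    Complex.slitPlane_ne_zero (hs θ hθ) (by rw [h, mul_zero])
  rw [intervalIntegral.integral_eq_sub_of_hasDerivAt
    (f := fun θ => Complex.log (-Complex.I * (G θ - a)))]
  · have e1 : -Complex.I * ((-r : ℂ) - a) = ((r + a : ℝ) : ℂ) * Complex.I := by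
      push_cast; ring
    have e2 : -Complex.I * ((r : ℂ) - a) = ((r - a : ℝ) : ℂ) * (-Complex.I) := by
      push_cast; ring
    rw [h0, h1, e1, e2, Complex.log_ofReal_mul (by linarith) Complex.I_ne_zero,
      Complex.log_ofReal_mul (by linarith) (neg_ne_zero.2 Complex.I_ne_zero), Complex.log_I,
      Complex.log_neg_I]
    simp
  · intro θ hθ
    rw [Set.uIcc_of_le hT] at hθ
    refine ((((hG θ).sub_const (a : ℂ)).const_mul (-Complex.I)).clog_real (hs θ hθ)).congr_deriv ?_
    rw [mul_div_mul_left _ _ (neg_ne_zero.2 Complex.I_ne_zero)]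
  · refine ContinuousOn.intervalIntegrable ?_
    rw [Set.uIcc_of_le hT]
    exact ContinuousOn.div hG'.continuousOn (by fun_prop) hne

end LogarithmicIntegrals

/-! ### The curve on which `t` is real -/

section Parametrisation

/-- The squared modulus of the point of argument `θ` on the curve in the plane of `G` on which
`t = (2 + G ^ 2) / (G * (2 - G ^ 2))` is real. -/
noncomputable def curveSq (θ : ℝ) : ℝ := 2 * √(4 * Real.cos θ ^ 4 + 1) - 4 * Real.cos θ ^ 2

lemma curveSq_pos (θ : ℝ) : 0 < curveSq θ := by
  have h1 : 0 < √(4 * Real.cos θ ^ 4 + 1) := Real.sqrt_pos.2 (by positivity)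
  have h2 : √(4 * Real.cos θ ^ 4 + 1) ^ 2 = 4 * Real.cos θ ^ 4 + 1 :=
    Real.sq_sqrt (by positivity)
  have : 2 * Real.cos θ ^ 2 < √(4 * Real.cos θ ^ 4 + 1) := by
    refine lt_of_pow_lt_pow_left₀ 2 h1.le ?_
    rw [h2]
    ring_nf
    linarith
  rw [curveSq]
  linarith

/-- This quadratic equation for `|G|²` is the condition that `t` be real at the point of argument
`θ`, for `sin θ ≠ 0`. -/
lemma curveSq_eq (θ : ℝ) : curveSq θ ^ 2 + 8 * curveSq θ * Real.cos θ ^ 2 = 4 := by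
  have h2 : √(4 * Real.cos θ ^ 4 + 1) ^ 2 = 4 * Real.cos θ ^ 4 + 1 :=
    Real.sq_sqrt (by positivity)
  rw [curveSq]
  linear_combination 4 * h2

lemma curveSq_le (θ : ℝ) : curveSq θ ≤ 2 := by
  have := curveSq_eq θ
  have := curveSq_pos θ
  have : 0 ≤ 8 * curveSq θ * Real.cos θ ^ 2 := by positivity
  nlinarith

/-- The least value is `2√5 - 4 ≈ 0.472`, at `θ = 0`. The bound keeps `|t|` below `3` and the
endpoints of the curve outside `[-0.6, 0.6]`. -/
lemma lt_curveSq (θ : ℝ) : 0.47 < curveSq θ := by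
  have h1 := curveSq_eq θ
  have h2 := curveSq_pos θ
  have h3 := mul_le_mul_of_nonneg_left (Real.cos_sq_le_one θ) h2.le
  nlinarith

lemma contDiff_curveSq : ContDiff ℝ 1 curveSq := by
  unfold curveSq
  refine ContDiff.sub (contDiff_const.mul (ContDiff.sqrt ?_ fun θ => ?_)) ?_
  · exact (contDiff_const.mul (Real.contDiff_cos.pow 4)).add contDiff_const
  · positivity
  · exact contDiff_const.mul (Real.contDiff_cos.pow 2)

/-- The modulus of the point of argument `θ` on the curve. -/
noncomputable def curveAbs (θ : ℝ) : ℝ := √(curveSq θ)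

lemma curveAbs_pos (θ : ℝ) : 0 < curveAbs θ := Real.sqrt_pos.2 (curveSq_pos θ)

lemma curveAbs_sq (θ : ℝ) : curveAbs θ ^ 2 = curveSq θ := Real.sq_sqrt (curveSq_pos θ).le

lemma contDiff_curveAbs : ContDiff ℝ 1 curveAbs :=
  contDiff_curveSq.sqrt fun θ => (curveSq_pos θ).ne'

/-- The point of argument `θ` on the curve. -/
noncomputable def curve (θ : ℝ) : ℂ :=
  (curveAbs θ : ℂ) * ((Real.cos θ : ℂ) + (Real.sin θ : ℂ) * Complex.I)

/-- The real parameter `t` corresponding to the point of argument `θ` on the curve. -/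
noncomputable def curveParam (θ : ℝ) : ℝ := 4 * Real.cos θ / (curveAbs θ * (2 + curveSq θ))

lemma contDiff_curveParam : ContDiff ℝ 1 curveParam := by
  refine ContDiff.div (contDiff_const.mul Real.contDiff_cos)
    (contDiff_curveAbs.mul (contDiff_const.add contDiff_curveSq)) fun θ => ?_
  have := curveSq_pos θ
  have := curveAbs_pos θ
  positivity

lemma contDiff_curve : ContDiff ℝ 1 curve := by
  have h : ∀ f : ℝ → ℝ, ContDiff ℝ 1 f → ContDiff ℝ 1 fun θ => (f θ : ℂ) := fun f hf =>
    Complex.ofRealCLM.contDiff.comp hf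
  exact (h _ contDiff_curveAbs).mul
    ((h _ Real.contDiff_cos).add ((h _ Real.contDiff_sin).mul contDiff_const))

lemma curveParam_mul (θ : ℝ) :
    curveParam θ * (curveAbs θ * (2 + curveSq θ)) = 4 * Real.cos θ := by
  have := curveSq_pos θ
  have := curveAbs_pos θ
  rw [curveParam, div_mul_cancel₀ _ (by positivity)]

lemma curveParam_sq (θ : ℝ) :
    curveParam θ ^ 2 * (curveSq θ ^ 2 * (2 + curveSq θ)) = 2 * (2 - curveSq θ) := by
  have h := curveParam_mul θ
  have h2 := curveAbs_sq θ
  have h3 := curveSq_eq θ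
  have h4 := curveSq_pos θ
  have e : (curveParam θ * (curveAbs θ * (2 + curveSq θ))) ^ 2 = (4 * Real.cos θ) ^ 2 := by rw [h]
  rw [mul_pow, mul_pow, h2] at e
  have h5 : (2 + curveSq θ) ≠ 0 := by positivity
  refine mul_right_cancel₀ h5 ?_
  linear_combination curveSq θ * e + 2 * h3

lemma abs_curveParam_lt (θ : ℝ) : |curveParam θ| < 3 := by
  have h := curveParam_sq θ
  have h1 := lt_curveSq θ
  have h2 := curveSq_le θ
  refine abs_lt_of_sq_lt_sq ?_ (by norm_num)
  have h3 : 0.47 ^ 2 * 2.47 ≤ curveSq θ ^ 2 * (2 + curveSq θ) := by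
    gcongr
    linarith
  have h4 := mul_le_mul_of_nonneg_left h3 (sq_nonneg (curveParam θ))
  rw [h] at h4
  norm_num at h4 ⊢
  linarith

/-- The algebraic equation of the curve. -/
lemma curve_eq (θ : ℝ) :
    (curveParam θ : ℂ) * (curve θ * (2 - curve θ ^ 2)) = 2 + curve θ ^ 2 := by
  have h1 : (curveParam θ : ℂ) * (curveAbs θ * (2 + curveSq θ)) = 4 * (Real.cos θ : ℂ) := by
    exact_mod_cast congrArg (fun x : ℝ => (x : ℂ)) (curveParam_mul θ)
  have h2 : (curveAbs θ : ℂ) ^ 2 = curveSq θ := by exact_mod_cast curveAbs_sq θ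
  have h3 : (curveSq θ : ℂ) ^ 2 + 8 * curveSq θ * (Real.cos θ : ℂ) ^ 2 = 4 := by
    exact_mod_cast curveSq_eq θ
  have h4 : (Real.sin θ : ℂ) ^ 2 + (Real.cos θ : ℂ) ^ 2 = 1 := by
    exact_mod_cast Real.sin_sq_add_cos_sq θ
  have h5 : (2 + curveSq θ : ℂ) ≠ 0 := by
    have := curveSq_pos θ
    exact_mod_cast (by positivity : (2 + curveSq θ) ≠ 0)
  set c := (Real.cos θ : ℂ)
  set s := (Real.sin θ : ℂ)
  set r := (curveAbs θ : ℂ)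
  set ρ := (curveSq θ : ℂ)
  set t := (curveParam θ : ℂ)
  have hcurve : curve θ = r * (c + s * Complex.I) := rfl
  set e := c + s * Complex.I with he
  -- Being unimodular with real part `c`, `e` is a root of `X² - 2 c X + 1`; reducing powers of `e`
  -- leaves only the real relations.
  have h6 : e ^ 2 = 2 * c * e - 1 := by
    rw [he]
    linear_combination s ^ 2 * Complex.I_sq - h4
  have hsq : curve θ ^ 2 = ρ * (2 * c * e - 1) := by
    rw [hcurve, mul_pow, h2, h6]
  refine mul_right_cancel₀ h5 ?_
  rw [hsq, hcurve]
  linear_combination e * (2 - ρ * (2 * c * e - 1)) * h1 - 8 * ρ * c ^ 2 * h6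
    - (2 * c * e - 1) * h3

lemma curve_im (θ : ℝ) : (curve θ).im = curveAbs θ * Real.sin θ := by
  rw [curve, Complex.im_ofReal_mul]
  simp [-Complex.ofReal_sin, -Complex.ofReal_cos]

/-- With `(Im G)² = ρ sin² θ`, the hypothesis on `q` in `tetillaCont_eq_of_param` is `curveSq_eq`
rewritten through `sin`. -/
lemma tetillaCont_curveParam {θ : ℝ} (hθ : θ ∈ Set.Icc 0 Real.pi) :
    tetillaCont (curveParam θ) = (curve θ).im / Real.pi := by
  rw [curve_im]
  refine tetillaCont_eq_of_param (curveSq_pos θ) (curveSq_le θ)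
    (mul_nonneg (curveAbs_pos θ).le (Real.sin_nonneg_of_mem_Icc hθ)) (curveParam_sq θ) ?_
  rw [mul_pow, curveAbs_sq]
  linear_combination (8 * curveSq θ) * Real.sin_sq_add_cos_sq θ - curveSq_eq θ

lemma curveAbs_pi : curveAbs Real.pi = curveAbs 0 := by
  simp [curveAbs, curveSq, even_two.neg_pow, (by decide : Even 4).neg_pow]

lemma curve_zero : curve 0 = curveAbs 0 := by simp [curve]

lemma curve_pi : curve Real.pi = -curveAbs 0 := by simp [curve, curveAbs_pi]

lemma curve_im_pos {θ : ℝ} (hθ : θ ∈ Set.Icc 0 Real.pi) :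
    curve θ = curveAbs 0 ∨ curve θ = -curveAbs 0 ∨ 0 < (curve θ).im := by
  rcases eq_or_lt_of_le hθ.1 with h | h
  · rw [← h]; exact Or.inl curve_zero
  rcases eq_or_lt_of_le hθ.2 with h' | h'
  · rw [h']; exact Or.inr (Or.inl curve_pi)
  · rw [curve_im]
    exact Or.inr (Or.inr (mul_pos (curveAbs_pos θ) (Real.sin_pos_of_pos_of_lt_pi h h')))

lemma curveAbs_zero_lt : curveAbs 0 < 0.7 := by
  have h1 := curveSq_eq 0
  have h2 := curveSq_pos 0
  rw [Real.cos_zero] at h1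
  refine lt_of_pow_lt_pow_left₀ 2 (by norm_num) ?_
  rw [curveAbs_sq]
  nlinarith

lemma lt_curveAbs_zero : 0.6 < curveAbs 0 := by
  have h1 := lt_curveSq 0
  refine lt_of_pow_lt_pow_left₀ 2 (curveAbs_pos 0).le ?_
  rw [curveAbs_sq]
  norm_num at h1 ⊢
  linarith

lemma curveParam_zero : curveParam 0 = √(11 + 5 * √5) / 2 := by
  have h5 : √5 ^ 2 = 5 := Real.sq_sqrt (by norm_num)
  have hρ : curveSq 0 = 2 * √5 - 4 := by
    rw [curveSq, Real.cos_zero]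
    norm_num
  have h := curveParam_sq 0
  have h0 : 0 ≤ curveParam 0 := by
    have := curveSq_pos 0
    have := curveAbs_pos 0
    rw [curveParam, Real.cos_zero]
    positivity
  have hsq : curveParam 0 ^ 2 = (√(11 + 5 * √5) / 2) ^ 2 := by
    rw [div_pow, Real.sq_sqrt (by positivity)]
    rw [hρ] at h
    have h2 : (0 : ℝ) < √5 - 2 := by
      have : 2 < √5 := by rw [Real.lt_sqrt] <;> norm_num
      linarith
    have h3 : (2 * √5 - 4) ^ 2 * (2 + (2 * √5 - 4)) ≠ 0 := by
      have : 0 < 2 * √5 - 4 := by linarith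
      positivity
    refine mul_right_cancel₀ h3 ?_
    rw [h]
    have h53 : √5 ^ 3 = 5 * √5 := by rw [pow_succ, h5]
    have h54 : √5 ^ 4 = 25 := by rw [show √5 ^ 4 = (√5 ^ 2) ^ 2 by ring, h5]; norm_num
    ring_nf
    rw [h54, h53, h5]
    ring
  exact (pow_left_inj₀ h0 (by positivity) two_ne_zero).1 hsq

lemma curveParam_pi : curveParam Real.pi = -curveParam 0 := by
  simp [curveParam, curveAbs_pi, curveSq, neg_div, (by decide : Even 4).neg_pow]

end Parametrisation

/-! ### The Stieltjes transform of the density -/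

section StieltjesTransform

lemma curve_sub_ne_zero {a θ : ℝ} (hθ : θ ∈ Set.Icc 0 Real.pi) (h1 : a ≠ curveAbs 0)
    (h2 : a ≠ -curveAbs 0) : curve θ - a ≠ 0 := by
  intro h
  rw [sub_eq_zero] at h
  rcases curve_im_pos hθ with e | e | e
  · rw [e] at h
    exact h1 (by exact_mod_cast h.symm)
  · rw [e] at h
    exact h2 (by exact_mod_cast h.symm)
  · rw [h] at e
    simp at e

/-- By `curve_eq` a zero of the denominator would be one of the numerator `2 + G²`, which is `2` at
`G = 0` and `4` at `G² = 2`. -/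
lemma curve_denom_ne_zero (θ : ℝ) : curve θ * (2 - curve θ ^ 2) ≠ 0 := by
  intro h
  have e := curve_eq θ
  rw [h, mul_zero] at e
  rcases mul_eq_zero.1 h with h | h
  · rw [h] at e
    norm_num at e
  · have : (4 : ℂ) = 0 := by linear_combination h - e
    norm_num at this

/-- The two roots, different from `g`, of the cubic equation satisfied by `g`. -/
lemma exists_outer_roots {g w : ℝ} (hg : |g| ≤ 0.1) (hw : w * (2 + g ^ 2) = g * (2 - g ^ 2)) :
    ∃ g₂ g₃ : ℝ, 0.7 < g₂ ∧ g₃ < -0.7 ∧ g + g₂ + g₃ = -w ∧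
      g * g₂ + g * g₃ + g₂ * g₃ = -2 ∧ g * g₂ * g₃ = -2 * w := by
  obtain ⟨hg1, hg2⟩ := abs_le.1 hg
  have hgsq : g ^ 2 ≤ 0.01 := by nlinarith
  have hw' : |w| ≤ 0.1 := by
    rw [abs_le]
    constructor <;> nlinarith
  obtain ⟨hw1, hw2⟩ := abs_le.1 hw'
  -- Dividing `X³ + w X² - 2 X + 2 w` by `X - g` leaves `X² + (g + w) X + c`, with discriminant
  -- `d²`.
  set c : ℝ := -2 + g * (g + w) with hc
  have hc1 : c ≤ -1.9 := by nlinarith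
  have hgc : g * c = -2 * w := by
    rw [hc]
    linear_combination hw
  set d := √((g + w) ^ 2 - 4 * c) with hd
  have hd2 : d ^ 2 = (g + w) ^ 2 - 4 * c := Real.sq_sqrt (by nlinarith)
  have hd3 : 2.5 < d := by
    refine Real.lt_sqrt_of_sq_lt ?_
    nlinarith [sq_nonneg (g + w)]
  refine ⟨(-(g + w) + d) / 2, (-(g + w) - d) / 2, by linarith, by linarith, by ring, ?_, ?_⟩
  · rw [show g * ((-(g + w) + d) / 2) + g * ((-(g + w) - d) / 2) +
      (-(g + w) + d) / 2 * ((-(g + w) - d) / 2) = -g * (g + w) + ((g + w) ^ 2 - d ^ 2) / 4 by ring,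
      hd2, hc]
    ring
  · rw [show g * ((-(g + w) + d) / 2) * ((-(g + w) - d) / 2) =
      g * ((g + w) ^ 2 - d ^ 2) / 4 by ring, hd2, ← hgc]
    ring

/-- Logarithmic differentiation of `∏ (X - aᵢ)`. -/
lemma sum_div_sub_eq {G a b c : ℂ} (ha : G - a ≠ 0) (hb : G - b ≠ 0) (hc : G - c ≠ 0) :
    a / (G - a) + b / (G - b) + c / (G - c) =
      G * ((G - b) * (G - c) + (G - a) * (G - c) + (G - a) * (G - b)) /
        ((G - a) * (G - b) * (G - c)) - 3 := by
  field_simp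
  ring

lemma deriv_curve_relation (θ : ℝ) :
    ((deriv curveParam θ : ℝ) : ℂ) * (curve θ * (2 - curve θ ^ 2)) +
      curveParam θ * ((2 - 3 * curve θ ^ 2) * deriv curve θ) = 2 * curve θ * deriv curve θ := by
  have hG : HasDerivAt curve (deriv curve θ) θ :=
    (contDiff_curve.differentiable one_ne_zero θ).hasDerivAt
  have ht : HasDerivAt (fun θ => (curveParam θ : ℂ)) ((deriv curveParam θ : ℝ) : ℂ) θ :=
    ((contDiff_curveParam.differentiable one_ne_zero θ).hasDerivAt).ofReal_comp
  have h1 := ht.mul (hG.mul ((hG.pow 2).const_sub 2))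
  have h2 := (hG.pow 2).const_add 2
  have e : ((fun θ => (curveParam θ : ℂ)) * (curve * fun θ => 2 - (curve ^ 2) θ)) =
      fun θ => 2 + (curve ^ 2) θ := by
    funext θ
    simpa using curve_eq θ
  rw [e] at h1
  have := h1.unique h2
  simp only [Pi.mul_apply, Pi.pow_apply] at this
  push_cast at this
  linear_combination this

/-- The differential form `-w G dt / (1 - w t)` in partial fractions. -/
lemma curve_partial_fractions {g g₂ g₃ w θ : ℝ} (h1 : g + g₂ + g₃ = -w)
    (h2 : g * g₂ + g * g₃ + g₂ * g₃ = -2) (h3 : g * g₂ * g₃ = -2 * w)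
    (hwt : 1 - w * curveParam θ ≠ 0)
    (hg : curve θ - g ≠ 0) (hg₂ : curve θ - g₂ ≠ 0) (hg₃ : curve θ - g₃ ≠ 0)
    (hs : curve θ - (√2 : ℝ) ≠ 0) (hs' : curve θ - (-√2 : ℝ) ≠ 0) :
    curve θ * ((-w * (deriv curveParam θ / (1 - w * curveParam θ)) : ℝ) : ℂ) =
      g * (deriv curve θ / (curve θ - g)) + g₂ * (deriv curve θ / (curve θ - g₂)) +
      g₃ * (deriv curve θ / (curve θ - g₃)) - (√2 : ℝ) * (deriv curve θ / (curve θ - (√2 : ℝ))) -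
      (-√2 : ℝ) * (deriv curve θ / (curve θ - (-√2 : ℝ))) := by
  have hD := curve_denom_ne_zero θ
  have hcurve := curve_eq θ
  have hder := deriv_curve_relation θ
  -- The denominator `G (2 - G²)` has roots `0, ±√2`. The root `0` gets weight `0` and disappears,
  -- and the constants `-3` from numerator and denominator cancel.
  have h0 : curve θ - 0 ≠ 0 := by
    rw [sub_zero]
    exact left_ne_zero_of_mul hD
  have hsum := sum_div_sub_eq hg hg₂ hg₃
  have hsum' := sum_div_sub_eq h0 hs hs'
  have h1' : (g : ℂ) + g₂ + g₃ = -w := by exact_mod_cast congrArg (fun x : ℝ => (x : ℂ)) h1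
  have h2' : (g : ℂ) * g₂ + g * g₃ + g₂ * g₃ = -2 := by
    exact_mod_cast congrArg (fun x : ℝ => (x : ℂ)) h2
  have h3' : (g : ℂ) * g₂ * g₃ = -2 * w := by
    exact_mod_cast congrArg (fun x : ℝ => (x : ℂ)) h3
  have hwt' : (1 - w * curveParam θ : ℂ) ≠ 0 := by exact_mod_cast hwt
  have hsq : ((√2 : ℝ) : ℂ) ^ 2 = 2 := by
    exact_mod_cast congrArg (fun x : ℝ => (x : ℂ)) (Real.sq_sqrt (show (0 : ℝ) ≤ 2 by norm_num))
  push_cast at hs' hsum' ⊢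
  set G := curve θ
  set G' := deriv curve θ
  set t := (curveParam θ : ℂ)
  set t' := ((deriv curveParam θ : ℝ) : ℂ)
  -- Up to sign, `1 - w t` is the cubic with roots `g, g₂, g₃` divided by `G (2 - G²)`; the left
  -- side of the goal is `G` times its logarithmic derivative.
  have eN : (G - g) * (G - g₂) * (G - g₃) = -((1 - w * t) * (G * (2 - G ^ 2))) := by
    linear_combination -G ^ 2 * h1' + G * h2' - h3' - w * hcurve
  have eN' : (G - g₂) * (G - g₃) + (G - g) * (G - g₃) + (G - g) * (G - g₂) =
      -(2 - 3 * G ^ 2 - 2 * w * G) := by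
    linear_combination -2 * G * h1' + h2'
  have eD : (G - 0) * (G - (√2 : ℝ)) * (G - -(√2 : ℝ)) = -(G * (2 - G ^ 2)) := by
    linear_combination -G * hsq
  have eD' : (G - (√2 : ℝ)) * (G - -(√2 : ℝ)) + (G - 0) * (G - -(√2 : ℝ)) +
      (G - 0) * (G - (√2 : ℝ)) = -(2 - 3 * G ^ 2) := by
    linear_combination -hsq
  rw [eN, eN'] at hsum
  rw [eD, eD', zero_div, zero_add] at hsum'
  have hL : -w * (t' / (1 - w * t)) =
      G' * (2 - 3 * G ^ 2 - 2 * w * G) / ((1 - w * t) * (G * (2 - G ^ 2))) -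
        G' * (2 - 3 * G ^ 2) / (G * (2 - G ^ 2)) := by
    have e : G' * (2 - 3 * G ^ 2 - 2 * w * G) =
        -w * (t' * (G * (2 - G ^ 2))) + (1 - w * t) * ((2 - 3 * G ^ 2) * G') := by
      linear_combination w * hder
    rw [e, add_div, mul_div_mul_left _ _ hwt', mul_comm G', add_sub_cancel_right,
      mul_comm (1 - w * t), ← mul_assoc, mul_comm _ (G * (2 - G ^ 2)),
      mul_div_mul_left _ _ hD, mul_div_assoc]
  rw [hL]
  have key : ∀ a b c d e : ℂ, a * (G' / (G - a)) + b * (G' / (G - b)) + c * (G' / (G - c)) -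
      d * (G' / (G - d)) - e * (G' / (G - e)) =
      G' * ((a / (G - a) + b / (G - b) + c / (G - c)) - (d / (G - d) + e / (G - e))) := by
    intro a b c d e
    ring
  rw [key, hsum, hsum', mul_neg, mul_neg, neg_div_neg_eq, neg_div_neg_eq]
  ring

lemma intervalIntegrable_curve_inv {a : ℝ} (h1 : a ≠ curveAbs 0) (h2 : a ≠ -curveAbs 0) :
    IntervalIntegrable (fun θ => deriv curve θ / (curve θ - a)) volume 0 Real.pi := by
  refine ContinuousOn.intervalIntegrable ?_
  rw [Set.uIcc_of_le Real.pi_pos.le]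
  refine ContinuousOn.div (contDiff_curve.continuous_deriv le_rfl).continuousOn ?_
    fun θ hθ => curve_sub_ne_zero hθ h1 h2
  exact (contDiff_curve.continuous.sub continuous_const).continuousOn

/-- The Stieltjes transform of the tetilla density, along a parametrised real neighbourhood of
infinity. -/
theorem integral_tetillaCont_div {g w : ℝ} (hg : |g| ≤ 0.1)
    (hw : w * (2 + g ^ 2) = g * (2 - g ^ 2)) :
    w * ∫ t in (-(√(11 + 5 * √5) / 2))..(√(11 + 5 * √5) / 2), tetillaCont t / (1 - w * t) = g := by
  obtain ⟨g₂, g₃, hg₂, hg₃, h1, h2, h3⟩ := exists_outer_roots hg hw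
  obtain ⟨hga, hgb⟩ := abs_le.1 hg
  have hgsq : g ^ 2 ≤ 0.01 := by nlinarith
  have hwabs : |w| ≤ 0.1 := by
    rw [abs_le]
    constructor <;> nlinarith
  have hr1 := lt_curveAbs_zero
  have hr2 := curveAbs_zero_lt
  have hs2 : 1 < √2 := by rw [Real.lt_sqrt] <;> norm_num
  have hwt : ∀ t : ℝ, |t| < 3 → 1 - w * t ≠ 0 := by
    intro t ht h
    have : |w * t| ≤ 0.1 * 3 := by
      rw [abs_mul]
      gcongr
    have := (abs_le.1 this).2
    norm_num at this
    linarith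
  have hG : ∀ θ, HasDerivAt curve (deriv curve θ) θ := fun θ =>
    (contDiff_curve.differentiable one_ne_zero θ).hasDerivAt
  have hG' : Continuous (deriv curve) := contDiff_curve.continuous_deriv le_rfl
  have him : ∀ θ ∈ Set.Icc 0 Real.pi,
      curve θ = curveAbs 0 ∨ curve θ = -curveAbs 0 ∨ 0 < (curve θ).im := fun θ => curve_im_pos
  -- The minus sign appears because `curveParam` starts at the right end of the support and ends at
  -- the left.
  have sub : ∫ θ in (0 : ℝ)..Real.pi, ((fun t => tetillaCont t / (1 - w * t)) ∘ curveParam) θ *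
      deriv curveParam θ =
      -∫ t in (-(√(11 + 5 * √5) / 2))..(√(11 + 5 * √5) / 2), tetillaCont t / (1 - w * t) := by
    rw [intervalIntegral.integral_comp_mul_deriv' (fun θ _ =>
      (contDiff_curveParam.differentiable one_ne_zero θ).hasDerivAt)
      (contDiff_curveParam.continuous_deriv le_rfl).continuousOn, curveParam_pi, curveParam_zero,
      intervalIntegral.integral_symm]
    refine ContinuousOn.div continuous_tetillaCont.continuousOn (by fun_prop) ?_
    rintro _ ⟨θ, _, rfl⟩
    exact hwt _ (abs_curveParam_lt θ)
  have I1 := intervalIntegrable_curve_inv (a := g) (by linarith) (by linarith)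
  have I2 := intervalIntegrable_curve_inv (a := g₂) (by linarith) (by linarith)
  have I3 := intervalIntegrable_curve_inv (a := g₃) (by linarith) (by linarith)
  have I4 := intervalIntegrable_curve_inv (a := √2) (by linarith) (by linarith)
  have I5 := intervalIntegrable_curve_inv (a := -√2) (by linarith) (by linarith)
  -- Of the five poles only `g` lies between the endpoints `±curveAbs 0` of the curve, whose modulus
  -- is between `0.6` and `0.7`.
  have V1 := im_integral_inv_sub_of_mem (a := g) Real.pi_pos.le hG hG' curve_zero curve_pi him
    (abs_lt.2 ⟨by linarith, by linarith⟩)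
  have V2 := im_integral_inv_sub_of_lt (a := g₂) Real.pi_pos.le hG hG' curve_zero curve_pi him
    (curveAbs_pos 0) (by linarith)
  have V3 := im_integral_inv_sub_of_gt (a := g₃) Real.pi_pos.le hG hG' curve_zero curve_pi him
    (curveAbs_pos 0) (by linarith)
  have V4 := im_integral_inv_sub_of_lt (a := √2) Real.pi_pos.le hG hG' curve_zero curve_pi him
    (curveAbs_pos 0) (by linarith)
  have V5 := im_integral_inv_sub_of_gt (a := -√2) Real.pi_pos.le hG hG' curve_zero curve_pi him
    (curveAbs_pos 0) (by linarith)
  have J1 := I1.const_mul (g : ℂ)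
  have J2 := I2.const_mul (g₂ : ℂ)
  have J3 := I3.const_mul (g₃ : ℂ)
  have J4 := I4.const_mul ((√2 : ℝ) : ℂ)
  have J5 := I5.const_mul ((-√2 : ℝ) : ℂ)
  have hint : (∫ θ in (0 : ℝ)..Real.pi,
      (g * (deriv curve θ / (curve θ - g)) + g₂ * (deriv curve θ / (curve θ - g₂)) +
      g₃ * (deriv curve θ / (curve θ - g₃)) - (√2 : ℝ) * (deriv curve θ / (curve θ - (√2 : ℝ))) -
      (-√2 : ℝ) * (deriv curve θ / (curve θ - (-√2 : ℝ))))).im = g * Real.pi := by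
    rw [intervalIntegral.integral_sub (((J1.add J2).add J3).sub J4) J5,
      intervalIntegral.integral_sub ((J1.add J2).add J3) J4,
      intervalIntegral.integral_add (J1.add J2) J3, intervalIntegral.integral_add J1 J2]
    simp only [intervalIntegral.integral_const_mul, Complex.sub_im, Complex.add_im,
      Complex.im_ofReal_mul, V1, V2, V3, V4, V5]
    ring
  have hcongr : ∫ θ in (0 : ℝ)..Real.pi, (-w * Real.pi) *
      (((fun t => tetillaCont t / (1 - w * t)) ∘ curveParam) θ * deriv curveParam θ) =
      ∫ θ in (0 : ℝ)..Real.pi,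
      (g * (deriv curve θ / (curve θ - g)) + g₂ * (deriv curve θ / (curve θ - g₂)) +
      g₃ * (deriv curve θ / (curve θ - g₃)) - (√2 : ℝ) * (deriv curve θ / (curve θ - (√2 : ℝ))) -
      (-√2 : ℝ) * (deriv curve θ / (curve θ - (-√2 : ℝ)))).im := by
    refine intervalIntegral.integral_congr fun θ hθ => ?_
    rw [Set.uIcc_of_le Real.pi_pos.le] at hθ
    have hh := curve_partial_fractions h1 h2 h3 (hwt _ (abs_curveParam_lt θ))
      (curve_sub_ne_zero hθ (by linarith) (by linarith))
      (curve_sub_ne_zero hθ (by linarith) (by linarith))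
      (curve_sub_ne_zero hθ (by linarith) (by linarith))
      (curve_sub_ne_zero hθ (by linarith) (by linarith))
      (curve_sub_ne_zero hθ (by linarith) (by linarith))
    simp only [Function.comp_apply]
    rw [← hh, Complex.im_mul_ofReal, tetillaCont_curveParam hθ]
    have := Real.pi_ne_zero
    field_simp
  have him' := Complex.imCLM.intervalIntegral_comp_comm ((((J1.add J2).add J3).sub J4).sub J5)
  simp only [Complex.imCLM_apply] at him'
  rw [him', hint, intervalIntegral.integral_const_mul, sub] at hcongr
  have := Real.pi_ne_zero
  refine mul_right_cancel₀ this ?_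
  linear_combination hcongr

end StieltjesTransform

/-! ### Evaluation of power series and isolation of zeros -/

section PowerSeriesEvaluation

/-- The power series `F` converges absolutely at `w`, with value `v`. -/
def HasEval (F : PowerSeries ℝ) (w v : ℝ) : Prop :=
  Summable (fun n => ‖PowerSeries.coeff n F * w ^ n‖) ∧ ∑' n, PowerSeries.coeff n F * w ^ n = v

lemma HasEval.add {F G : PowerSeries ℝ} {w u v : ℝ} (hF : HasEval F w u) (hG : HasEval G w v) :
    HasEval (F + G) w (u + v) := by
  simp only [HasEval, map_add, add_mul]
  refine ⟨(hF.1.add hG.1).of_nonneg_of_le (fun _ => norm_nonneg _) fun _ => norm_add_le _ _, ?_⟩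
  rw [hF.1.of_norm.tsum_add hG.1.of_norm, hF.2, hG.2]

lemma HasEval.mul {F G : PowerSeries ℝ} {w u v : ℝ} (hF : HasEval F w u) (hG : HasEval G w v) :
    HasEval (F * G) w (u * v) := by
  have e : ∀ n, PowerSeries.coeff n (F * G) * w ^ n = ∑ kl ∈ Finset.HasAntidiagonal.antidiagonal n,
      (PowerSeries.coeff kl.1 F * w ^ kl.1) * (PowerSeries.coeff kl.2 G * w ^ kl.2) := by
    intro n
    rw [PowerSeries.coeff_mul, Finset.sum_mul]
    refine Finset.sum_congr rfl fun kl hkl => ?_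
    rw [← Finset.HasAntidiagonal.mem_antidiagonal.1 hkl, pow_add]
    ring
  have h1 := summable_norm_sum_mul_antidiagonal_of_summable_norm hF.1 hG.1
  have h2 := tsum_mul_tsum_eq_tsum_sum_antidiagonal_of_summable_norm hF.1 hG.1
  rw [hF.2, hG.2] at h2
  exact ⟨h1.congr fun n => by rw [e], (tsum_congr e).trans h2.symm⟩

lemma HasEval.pow {F : PowerSeries ℝ} {w u : ℝ} (hF : HasEval F w u) {n : ℕ} (hn : n ≠ 0) :
    HasEval (F ^ n) w (u ^ n) := by
  induction n with
  | zero => exact absurd rfl hn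
  | succ n ih =>
    rcases eq_or_ne n 0 with rfl | h
    · simpa using hF
    · rw [pow_succ, pow_succ]
      exact (ih h).mul hF

lemma hasEval_C (c w : ℝ) : HasEval (PowerSeries.C c) w c := by
  have h : ∀ n, n ∉ ({0} : Finset ℕ) → PowerSeries.coeff n (PowerSeries.C c) * w ^ n = 0 := by
    intro n hn
    rw [PowerSeries.coeff_C, if_neg (by simpa using hn), zero_mul]
  refine ⟨summable_of_ne_finset_zero (s := {0}) fun n hn => by rw [h n hn, norm_zero], ?_⟩
  rw [tsum_eq_sum h]
  simp

lemma hasEval_X (w : ℝ) : HasEval PowerSeries.X w w := by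
  have h : ∀ n, n ∉ ({1} : Finset ℕ) → PowerSeries.coeff n (PowerSeries.X : PowerSeries ℝ) * w ^ n
      = 0 := by
    intro n hn
    rw [PowerSeries.coeff_X, if_neg (by simpa using hn), zero_mul]
  refine ⟨summable_of_ne_finset_zero (s := {1}) fun n hn => by rw [h n hn, norm_zero], ?_⟩
  rw [tsum_eq_sum h]
  simp

/-- A convergent power series with zeros accumulating at the origin vanishes. -/
lemma eq_zero_of_frequently_hasEval {F : PowerSeries ℝ} {ρ v : ℝ} (hρ : 0 < ρ)
    (hF : HasEval F ρ v) (h : ∃ᶠ w in nhdsWithin (0 : ℝ) {0}ᶜ, HasEval F w 0) : F = 0 := by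
  set p := FormalMultilinearSeries.ofScalars ℝ (fun n => PowerSeries.coeff n F) with hp
  have hr : 0 < p.radius := by
    obtain ⟨r, rfl⟩ : ∃ r : NNReal, (r : ℝ) = ρ := ⟨⟨ρ, hρ.le⟩, rfl⟩
    have : (r : ENNReal) ≤ p.radius := by
      refine p.le_radius_of_summable ?_
      refine hF.1.congr fun n => ?_
      rw [hp, FormalMultilinearSeries.ofScalars_norm, norm_mul, norm_pow, Real.norm_of_nonneg hρ.le]
    refine lt_of_lt_of_le ?_ this
    exact_mod_cast hρ
  have hps := (p.hasFPowerSeriesOnBall hr).hasFPowerSeriesAt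
  have hp0 : p = 0 := by
    by_contra hne
    refine h ((hps.locally_ne_zero hne).mono fun w hw hv => hw ?_)
    have e : p.sum w = ∑' n, PowerSeries.coeff n F • w ^ n :=
      FormalMultilinearSeries.ofScalars_sum_eq _ w
    rw [e]
    simpa using hv.2
  ext n
  have : p n = 0 := by rw [hp0]; rfl
  simpa using (FormalMultilinearSeries.ofScalars_eq_zero ℝ n).1 this

end PowerSeriesEvaluation

/-! ### The moment series of the density -/

section TetillaMoments

/-- The moments of the tetilla density. -/
noncomputable def tetillaMoment (n : ℕ) : ℝ :=
  ∫ t in (-(√(11 + 5 * √5) / 2))..(√(11 + 5 * √5) / 2), t ^ n * tetillaCont t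

lemma tetilla_endpoint_lt : √(11 + 5 * √5) / 2 < 3 := by
  rw [← curveParam_zero]
  exact lt_of_abs_lt (abs_curveParam_lt 0)

lemma abs_le_three_of_mem {t : ℝ}
    (ht : t ∈ Set.uIoc (-(√(11 + 5 * √5) / 2)) (√(11 + 5 * √5) / 2)) : |t| ≤ 3 := by
  have h := tetilla_endpoint_lt
  rw [Set.uIoc_of_le (neg_le_self (by positivity))] at ht
  rw [abs_le]
  constructor <;> linarith [ht.1, ht.2]

/-- Geometric expansion of `1 / (1 - w t)` under the integral, dominated since `|w t| ≤ 0.3` on the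
support. -/
lemma hasEval_tetillaMoment {w : ℝ} (hw : |w| ≤ 0.1) :
    HasEval (PowerSeries.mk tetillaMoment) w
      (∫ t in (-(√(11 + 5 * √5) / 2))..(√(11 + 5 * √5) / 2), tetillaCont t / (1 - w * t)) := by
  have hwt : ∀ t, t ∈ Set.uIoc (-(√(11 + 5 * √5) / 2)) (√(11 + 5 * √5) / 2) →
      |w * t| ≤ 0.3 := by
    intro t ht
    rw [abs_mul]
    calc |w| * |t| ≤ 0.1 * 3 := by
          gcongr
          exact abs_le_three_of_mem ht
      _ = 0.3 := by norm_num
  have hbound : ∀ (n : ℕ) t, t ∈ Set.uIoc (-(√(11 + 5 * √5) / 2)) (√(11 + 5 * √5) / 2) →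
      ‖(w * t) ^ n * tetillaCont t‖ ≤ 0.3 ^ n * tetillaCont t := by
    intro n t ht
    rw [norm_mul, norm_pow, Real.norm_eq_abs, Real.norm_of_nonneg (tetillaCont_nonneg t)]
    gcongr
    · exact tetillaCont_nonneg t
    · exact hwt t ht
  have hgeo := summable_geometric_of_lt_one (r := (0.3 : ℝ)) (by norm_num) (by norm_num)
  have e : ∀ n, PowerSeries.coeff n (PowerSeries.mk tetillaMoment) * w ^ n =
      ∫ t in (-(√(11 + 5 * √5) / 2))..(√(11 + 5 * √5) / 2), (w * t) ^ n * tetillaCont t := by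
    intro n
    rw [PowerSeries.coeff_mk, tetillaMoment, mul_comm, ← intervalIntegral.integral_const_mul]
    refine intervalIntegral.integral_congr fun t _ => ?_
    simp only [mul_pow]
    ring
  simp only [HasEval, e]
  constructor
  · refine Summable.of_nonneg_of_le (fun _ => norm_nonneg _) (fun n => ?_) (hgeo.mul_right
      (∫ t in (-(√(11 + 5 * √5) / 2))..(√(11 + 5 * √5) / 2), tetillaCont t))
    rw [← intervalIntegral.integral_const_mul]
    refine intervalIntegral.norm_integral_le_of_norm_le (neg_le_self (by positivity)) ?_ ?_
    · refine Filter.Eventually.of_forall fun t ht => hbound n t ?_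
      rwa [Set.uIoc_of_le (neg_le_self (by positivity))]
    · exact (continuous_const.mul continuous_tetillaCont).intervalIntegrable _ _
  · refine (intervalIntegral.hasSum_integral_of_dominated_convergence
      (fun n t => 0.3 ^ n * tetillaCont t) ?_ ?_ ?_ ?_ ?_).tsum_eq
    · intro n
      have := continuous_tetillaCont
      exact Continuous.aestronglyMeasurable (by fun_prop)
    · exact fun n => Filter.Eventually.of_forall fun t ht => hbound n t ht
    · exact Filter.Eventually.of_forall fun t _ => hgeo.mul_right _
    · simp only [tsum_mul_right]
      exact (continuous_const.mul continuous_tetillaCont).intervalIntegrable _ _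
    · refine Filter.Eventually.of_forall fun t ht => ?_
      have h := (hasSum_geometric_of_abs_lt_one (r := w * t)
        (lt_of_le_of_lt (hwt t ht) (by norm_num))).mul_right (tetillaCont t)
      rwa [inv_mul_eq_div] at h

/-- The moment series of the tetilla density solves a cubic equation. -/
theorem tetillaMoment_cubic {A : PowerSeries ℝ} (hA : A = PowerSeries.mk tetillaMoment) :
    A = 1 + PowerSeries.C (1 / 2) * PowerSeries.X ^ 2 * (A ^ 2 + A ^ 3) := by
  have hF : ∀ {w v : ℝ}, HasEval A w v →
      HasEval (A + PowerSeries.C (-1) + PowerSeries.C (-1 / 2) * PowerSeries.X ^ 2 *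
        (A ^ 2 + A ^ 3)) w (v + -1 + -1 / 2 * w ^ 2 * (v ^ 2 + v ^ 3)) := by
    intro w v h
    exact (h.add (hasEval_C _ _)).add (((hasEval_C _ _).mul ((hasEval_X w).pow two_ne_zero)).mul
      ((h.pow two_ne_zero).add (h.pow three_ne_zero)))
  have key : A + PowerSeries.C (-1) + PowerSeries.C (-1 / 2) * PowerSeries.X ^ 2 *
      (A ^ 2 + A ^ 3) = 0 := by
    refine eq_zero_of_frequently_hasEval (ρ := 0.1) (by norm_num)
      (hF (hA ▸ hasEval_tetillaMoment (w := 0.1) (by norm_num [abs_of_pos]))) ?_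
    -- Points `w` are produced from `g` rather than conversely, so the cubic never has to be solved
    -- for its small root; it suffices that nonzero `w` accumulate at `0`.
    have htend : Filter.Tendsto (fun g : ℝ => g * (2 - g ^ 2) / (2 + g ^ 2))
        (nhdsWithin 0 {0}ᶜ) (nhdsWithin 0 {0}ᶜ) := by
      refine tendsto_nhdsWithin_iff.2 ⟨?_, ?_⟩
      · have hc : Continuous fun g : ℝ => g * (2 - g ^ 2) / (2 + g ^ 2) :=
          Continuous.div (by fun_prop) (by fun_prop) fun g => by positivity
        have := hc.tendsto 0
        simp only [zero_mul, zero_div] at this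
        exact this.mono_left nhdsWithin_le_nhds
      · have h1 : ∀ᶠ g : ℝ in nhdsWithin 0 {0}ᶜ, |g| < 0.1 := by
          refine nhdsWithin_le_nhds ?_
          have := (continuous_abs (G := ℝ)).tendsto 0
          rw [abs_zero] at this
          exact this.eventually_lt_const (by norm_num)
        filter_upwards [h1, self_mem_nhdsWithin] with g hg hg0
        obtain ⟨ha, hb⟩ := abs_lt.1 hg
        have : 0 < 2 - g ^ 2 := by nlinarith
        have hg0' : g ≠ 0 := hg0
        have : g * (2 - g ^ 2) / (2 + g ^ 2) ≠ 0 := by positivity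
        exact this
    refine htend.frequently (p := fun w => HasEval _ w 0) (Filter.Eventually.frequently ?_)
    have h1 : ∀ᶠ g : ℝ in nhdsWithin 0 {0}ᶜ, |g| < 0.1 := by
      refine nhdsWithin_le_nhds ?_
      have := (continuous_abs (G := ℝ)).tendsto 0
      rw [abs_zero] at this
      exact this.eventually_lt_const (by norm_num)
    filter_upwards [h1, htend self_mem_nhdsWithin] with g hg hw0
    obtain ⟨ha, hb⟩ := abs_lt.1 hg
    set w := g * (2 - g ^ 2) / (2 + g ^ 2) with hwdef
    have hw : w * (2 + g ^ 2) = g * (2 - g ^ 2) := by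
      rw [hwdef, div_mul_cancel₀ _ (by positivity)]
    have hw0' : w ≠ 0 := hw0
    have hwabs : |w| ≤ 0.1 := by
      rw [abs_le]
      constructor <;> nlinarith
    have hv := integral_tetillaCont_div hg.le hw
    have hev := hF (hA ▸ hasEval_tetillaMoment hwabs)
    set v := ∫ t in (-(√(11 + 5 * √5) / 2))..(√(11 + 5 * √5) / 2), tetillaCont t / (1 - w * t)
    -- Substituting `g = w v` into the relation between `g` and `w` gives the cubic in `v` times
    -- `w`, up to a constant factor.
    have e : v + -1 + -1 / 2 * w ^ 2 * (v ^ 2 + v ^ 3) = 0 := by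
      refine mul_left_cancel₀ hw0' ?_
      rw [← hv] at hw
      linear_combination -(1 / 2) * hw
    rwa [e] at hev
  have e1 : (PowerSeries.C (-1) : PowerSeries ℝ) = -1 := by simp
  have e2 : (PowerSeries.C (-1 / 2) : PowerSeries ℝ) = -PowerSeries.C (1 / 2) := by
    rw [← map_neg]
    norm_num
  rw [e1, e2] at key
  linear_combination key

/-- The constant coefficient of the cubic equation gives the total mass, with no further
integration. -/
lemma tetillaMoment_zero : tetillaMoment 0 = 1 := by
  have h := congrArg (PowerSeries.coeff 0) (tetillaMoment_cubic rfl)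
  simpa using h

end TetillaMoments

/-! ### Determinacy of the moment problem for bounded support -/

section MomentDeterminacy

/-- Markov's inequality for `t ^ (2n)` bounds the mass of `|t| ≥ R + 1` by a multiple of `(R / (R +
1)) ^ (2n)`, which tends to `0`. -/
lemma ae_abs_lt_of_moments_eq {μ ν : Measure ℝ} [IsFiniteMeasure μ] [IsFiniteMeasure ν] {R : ℝ}
    (hR : 0 ≤ R) (hν : ∀ᵐ t ∂ν, |t| ≤ R) (hμi : ∀ n : ℕ, Integrable (fun t : ℝ => t ^ n) μ)
    (h : ∀ n : ℕ, ∫ t, t ^ n ∂μ = ∫ t, t ^ n ∂ν) : ∀ᵐ t ∂μ, |t| < R + 1 := by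
  have h1 : ∀ n : ℕ, μ.real {t | R + 1 ≤ |t|} ≤ (R ^ 2 / (R + 1) ^ 2) ^ n * ν.real Set.univ := by
    intro n
    have e1 := mul_meas_ge_le_integral_of_nonneg (μ := μ) (f := fun t : ℝ => t ^ (2 * n))
      (Filter.Eventually.of_forall fun t => (even_two_mul n).pow_nonneg t) (hμi (2 * n))
      ((R + 1) ^ (2 * n))
    have e2 : ∫ t, t ^ (2 * n) ∂ν ≤ R ^ (2 * n) * ν.real Set.univ := by
      refine (le_abs_self _).trans ?_
      rw [← Real.norm_eq_abs]
      refine norm_integral_le_of_norm_le_const ?_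
      filter_upwards [hν] with t ht
      rw [norm_pow, Real.norm_eq_abs]
      gcongr
    have e3 : {t : ℝ | R + 1 ≤ |t|} ⊆ {t | (R + 1) ^ (2 * n) ≤ t ^ (2 * n)} := by
      intro t ht
      rw [Set.mem_ofPred_eq, ← (even_two_mul n).pow_abs t]
      exact pow_le_pow_left₀ (by positivity) ht _
    have e4 := measureReal_mono (μ := μ) e3
    rw [h] at e1
    have e5 := mul_le_mul_of_nonneg_left e4 (by positivity : 0 ≤ (R + 1) ^ (2 * n))
    have e6 := e5.trans (e1.trans e2)
    rw [div_pow, ← pow_mul, ← pow_mul, div_mul_eq_mul_div, le_div_iff₀ (by positivity)]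
    linarith
  have h2 : Filter.Tendsto (fun n : ℕ => (R ^ 2 / (R + 1) ^ 2) ^ n * ν.real Set.univ) Filter.atTop
      (nhds (0 * ν.real Set.univ)) := by
    refine (tendsto_pow_atTop_nhds_zero_of_lt_one (by positivity) ?_).mul_const _
    rw [div_lt_one (by positivity)]
    gcongr
    linarith
  have h3 : μ.real {t | R + 1 ≤ |t|} = 0 := by
    refine le_antisymm ?_ measureReal_nonneg
    rw [zero_mul] at h2
    exact ge_of_tendsto' h2 h1
  rw [measureReal_eq_zero_iff] at h3
  rw [ae_iff]
  simpa using h3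

lemma integral_polynomial_eq {μ ν : Measure ℝ} (hμi : ∀ n : ℕ, Integrable (fun t : ℝ => t ^ n) μ)
    (hνi : ∀ n : ℕ, Integrable (fun t : ℝ => t ^ n) ν)
    (h : ∀ n : ℕ, ∫ t, t ^ n ∂μ = ∫ t, t ^ n ∂ν) (p : Polynomial ℝ) :
    Integrable (fun t => p.eval t) μ ∧ Integrable (fun t => p.eval t) ν ∧
      ∫ t, p.eval t ∂μ = ∫ t, p.eval t ∂ν := by
  induction p using Polynomial.induction_on' with
  | add p q hp hq =>
    simp only [Polynomial.eval_add]
    refine ⟨hp.1.add hq.1, hp.2.1.add hq.2.1, ?_⟩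
    rw [integral_add hp.1 hq.1, integral_add hp.2.1 hq.2.1, hp.2.2, hq.2.2]
  | monomial n c =>
    simp only [Polynomial.eval_monomial]
    refine ⟨(hμi n).const_mul c, (hνi n).const_mul c, ?_⟩
    rw [integral_const_mul, integral_const_mul, h]

lemma abs_integral_sub_le {μ : Measure ℝ} [IsProbabilityMeasure μ] {S ε : ℝ}
    (hμ : ∀ᵐ t ∂μ, |t| < S) {f g : ℝ → ℝ} (hf : Integrable f μ) (hg : Integrable g μ)
    (h : ∀ t ∈ Set.Icc (-S) S, |g t - f t| < ε) : |∫ t, g t ∂μ - ∫ t, f t ∂μ| ≤ ε := by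
  rw [← integral_sub hg hf, ← Real.norm_eq_abs]
  have := norm_integral_le_of_norm_le_const (μ := μ) (f := fun t => g t - f t) (C := ε) (by
    filter_upwards [hμ] with t ht
    exact (h t ⟨(abs_lt.1 ht).1.le, (abs_lt.1 ht).2.le⟩).le)
  simpa using this

/-- A probability measure with the moments of a boundedly supported one coincides with it. -/
theorem measure_eq_of_moments_eq {μ ν : Measure ℝ} [IsProbabilityMeasure μ]
    [IsProbabilityMeasure ν] {R : ℝ} (hR : 0 ≤ R) (hν : ∀ᵐ t ∂ν, |t| ≤ R)
    (hμi : ∀ n : ℕ, Integrable (fun t : ℝ => t ^ n) μ)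
    (hνi : ∀ n : ℕ, Integrable (fun t : ℝ => t ^ n) ν)
    (h : ∀ n : ℕ, ∫ t, t ^ n ∂μ = ∫ t, t ^ n ∂ν) : μ = ν := by
  have hμ' := ae_abs_lt_of_moments_eq hR hν hμi h
  have hν' : ∀ᵐ t ∂ν, |t| < R + 1 := hν.mono fun t ht => by linarith
  refine ext_of_forall_integral_eq_of_IsFiniteMeasure fun f => ?_
  refine eq_of_forall_dist_le fun ε hε => ?_
  -- Both measures live on `[-(R + 1), R + 1]`, where Weierstrass approximation reduces a continuous
  -- test function to a polynomial.
  obtain ⟨p, hp⟩ := exists_polynomial_near_of_continuousOn (-(R + 1)) (R + 1) f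
    f.continuous.continuousOn (ε / 2) (by positivity)
  obtain ⟨hp1, hp2, hp3⟩ := integral_polynomial_eq hμi hνi h p
  have e1 := abs_integral_sub_le hμ' (f.integrable μ) hp1 hp
  have e2 := abs_integral_sub_le hν' (f.integrable ν) hp2 hp
  rw [hp3] at e1
  rw [Real.dist_eq, abs_le]
  rw [abs_le] at e1 e2
  constructor <;> linarith [e1.1, e1.2, e2.1, e2.2]

end MomentDeterminacy

/-! ### The probability measure with the tetilla density -/

section TetillaMeasure

/-- The measure with density `tetillaDensity`. -/
noncomputable def tetillaMeasure : Measure ℝ :=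
  volume.withDensity fun t => ENNReal.ofReal (tetillaDensity t)

lemma hasCompactSupport_tetillaCont : HasCompactSupport tetillaCont :=
  HasCompactSupport.intro (K := Set.Icc (-(√(11 + 5 * √5) / 2)) (√(11 + 5 * √5) / 2))
    isCompact_Icc fun _ => tetillaCont_eq_zero

lemma integrable_pow_mul_tetillaCont (n : ℕ) :
    Integrable (fun t : ℝ => t ^ n * tetillaCont t) volume := by
  have h := continuous_tetillaCont
  exact Continuous.integrable_of_hasCompactSupport (by fun_prop)
    hasCompactSupport_tetillaCont.mul_left

lemma integral_pow_mul_tetillaCont (n : ℕ) :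
    ∫ t : ℝ, t ^ n * tetillaCont t = tetillaMoment n := by
  rw [tetillaMoment, intervalIntegral.integral_of_le (neg_le_self (by positivity)),
    ← integral_Icc_eq_integral_Ioc, setIntegral_eq_integral_of_forall_compl_eq_zero]
  intro t ht
  rw [tetillaCont_eq_zero ht, mul_zero]

lemma toReal_tetilla_smul_ae_eq (n : ℕ) :
    (fun t : ℝ => (ENNReal.ofReal (tetillaDensity t)).toReal • t ^ n) =ᵐ[volume]
      fun t => t ^ n * tetillaCont t := by
  filter_upwards [tetillaDensity_ae_eq] with t ht
  rw [ENNReal.toReal_ofReal (tetillaDensity_nonneg t), ht, smul_eq_mul, mul_comm]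

lemma integrable_pow_tetillaMeasure (n : ℕ) :
    Integrable (fun t : ℝ => t ^ n) tetillaMeasure := by
  rw [tetillaMeasure, integrable_withDensity_iff_integrable_smul'
    measurable_tetillaDensity.ennreal_ofReal (by simp),
    integrable_congr (toReal_tetilla_smul_ae_eq n)]
  exact integrable_pow_mul_tetillaCont n

lemma integral_pow_tetillaMeasure (n : ℕ) :
    ∫ t, t ^ n ∂tetillaMeasure = tetillaMoment n := by
  rw [tetillaMeasure, integral_withDensity_eq_integral_toReal_smul
    measurable_tetillaDensity.ennreal_ofReal (by simp),
    integral_congr_ae (toReal_tetilla_smul_ae_eq n), integral_pow_mul_tetillaCont]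

instance isProbabilityMeasure_tetillaMeasure : IsProbabilityMeasure tetillaMeasure := by
  constructor
  have h1 : Integrable tetillaDensity volume := by
    rw [integrable_congr tetillaDensity_ae_eq]
    simpa using integrable_pow_mul_tetillaCont 0
  have h2 : ∫ t, tetillaDensity t = 1 := by
    rw [integral_congr_ae tetillaDensity_ae_eq, ← tetillaMoment_zero,
      ← integral_pow_mul_tetillaCont]
    simp
  rw [tetillaMeasure, withDensity_apply _ MeasurableSet.univ, Measure.restrict_univ,
    ← ofReal_integral_eq_lintegral_ofReal h1 (Filter.Eventually.of_forall tetillaDensity_nonneg),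
    h2, ENNReal.ofReal_one]

lemma ae_abs_le_tetillaMeasure : ∀ᵐ t ∂tetillaMeasure, |t| ≤ √(11 + 5 * √5) / 2 := by
  rw [tetillaMeasure, ae_withDensity_iff measurable_tetillaDensity.ennreal_ofReal]
  refine Filter.Eventually.of_forall fun t ht => ?_
  by_contra h
  refine ht ?_
  rw [abs_le, ← Set.mem_Icc] at h
  rw [tetillaDensity, Set.indicator_of_notMem h, ENNReal.ofReal_zero]

end TetillaMeasure

/-! ### Comparison of the two moment sequences -/

namespace TracialWStarProbabilitySpace

variable {H : Type*} [NormedAddCommGroup H] [InnerProductSpace ℂ H] [CompleteSpace H]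

lemma Free.listFree {P : TracialWStarProbabilitySpace H} {ι : Type*} {z : ι → P.Elem}
    (h : P.Free z) : ListFree P.E z := by
  intro l hl hne
  obtain ⟨c, l, rfl⟩ := List.exists_cons_of_ne_nil hne
  have := h l.length (fun j => ((c :: l).get j).1)
    (fun j => FreeAlgebra.lift ℂ z ((c :: l).get j).2) ?_ ?_ ?_
  · have e : List.ofFn (fun j : Fin (l.length + 1) => FreeAlgebra.lift ℂ z ((c :: l).get j).2) =
        ((c :: l).map Prod.snd).map (FreeAlgebra.lift ℂ z) := by
      rw [List.map_map]
      conv_rhs => rw [← List.ofFn_get (c :: l), List.map_ofFn]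
      rfl
    rw [e] at this
    rw [listProd, map_list_prod]
    exact this
  · intro j
    have hj := (hl.2 _ (List.get_mem (c :: l) j)).1
    have : FreeAlgebra.lift ℂ z ((c :: l).get j).2 ∈ Subalgebra.map (FreeAlgebra.lift ℂ z)
        (Algebra.adjoin ℂ {FreeAlgebra.ι ℂ ((c :: l).get j).1}) := ⟨_, hj, rfl⟩
    rwa [AlgHom.map_adjoin_singleton, FreeAlgebra.lift_ι_apply] at this
  · intro j
    exact (hl.2 _ (List.get_mem (c :: l) j)).2
  · intro j
    exact List.isChain_iff_getElem.1 hl.1 j.1 (by simp)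

lemma IsLaw.semicircular_moment_succ {P : TracialWStarProbabilitySpace H} {a : P.Elem}
    (h : P.IsLaw a (semicircularLaw 1)) (n : ℕ) :
    P.E (a ^ (n + 1)) = ∑ j ∈ Finset.range n, P.E (a ^ j) * P.E (a ^ (n - 1 - j)) := by
  have := h.1
  have h0 : semicircularMoment 0 = 1 := by simp [semicircularMoment]
  have e : ∀ m, P.E (a ^ m) = (semicircularMoment m : ℂ) := fun m => (h.2 m).2
  simp only [e]
  rw [semicircularMoment_succ h0]
  push_cast
  rfl

/-- The moments of the normalised anticommutator of two free semicircular variables. -/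
theorem map_anticommutator_pow (P : TracialWStarProbabilitySpace H) {x y : P.Elem}
    (hxy : P.Free ![x, y]) (hx : P.IsLaw x (semicircularLaw 1))
    (hy : P.IsLaw y (semicircularLaw 1)) (n : ℕ) :
    P.E ((((1 / √2 : ℝ) : ℂ) • (x * y + y * x)) ^ n) = (tetillaMoment n : ℂ) := by
  have hSD : SchwingerDyson P.E ![x, y] := by
    intro i w
    have := schwingerDyson hxy.listFree P.map_one (fun i n => by
      fin_cases i
      · exact hx.semicircular_moment_succ n
      · exact hy.semicircular_moment_succ n) i w
    rwa [map_mul, FreeAlgebra.lift_ι_apply] at this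
  have hcub := hSD.cubic P.map_one P.tracial (i := 0) (j := 1) (by decide)
    (t := x * y + y * x) (by simp) rfl
  set M := PowerSeries.mk fun n => P.E ((x * y + y * x) ^ n) with hM
  set c : ℂ := ((1 / √2 : ℝ) : ℂ) with hc
  have hc2 : c ^ 2 = 1 / 2 := by
    rw [hc]
    norm_cast
    rw [div_pow, Real.sq_sqrt (by norm_num)]
    norm_num
  -- Rescaling sends `X²` to `c² X² = X² / 2`, which turns the cubic of the anticommutator into that
  -- of the density.
  have e1 : PowerSeries.rescale c M = 1 + PowerSeries.C (1 / 2 : ℂ) * PowerSeries.X ^ 2 *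
      (PowerSeries.rescale c M ^ 2 + PowerSeries.rescale c M ^ 3) := by
    conv_lhs => rw [hcub]
    simp only [map_add, map_mul, map_pow, _root_.map_one, PowerSeries.rescale_X]
    rw [mul_pow, ← map_pow, hc2]
  set A := PowerSeries.mk tetillaMoment with hA
  have e2 : PowerSeries.map Complex.ofRealHom A =
      1 + PowerSeries.C (1 / 2 : ℂ) * PowerSeries.X ^ 2 *
      (PowerSeries.map Complex.ofRealHom A ^ 2 + PowerSeries.map Complex.ofRealHom A ^ 3) := by
    conv_lhs => rw [tetillaMoment_cubic hA]
    simp only [map_add, map_mul, map_pow, _root_.map_one, PowerSeries.map_X, PowerSeries.map_C]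
    norm_num
  have e3 := congrArg (PowerSeries.coeff n) (eq_of_cubic _ e1 e2)
  rw [PowerSeries.coeff_rescale, hM, PowerSeries.coeff_mk, PowerSeries.coeff_map, hA,
    PowerSeries.coeff_mk] at e3
  rw [smul_pow, map_smul, smul_eq_mul]
  exact e3

end TracialWStarProbabilitySpace

/-- The tetilla law, i.e. the law of `(xy + yx)/√2` for free semicircular random variables `x`, `y`
of variance one, is the measure `h(t) dt` with `h` the explicit density `tetillaDensity`, which is
a nonnegative measurable function of compact support. -/
theorem proposition2p7 {H : Type*} [NormedAddCommGroup H] [InnerProductSpace ℂ H] [CompleteSpace H]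
    (P : TracialWStarProbabilitySpace H) (x y : P.Elem)
    (hx : IsSelfAdjoint x) (hy : IsSelfAdjoint y)
    (hxy : P.Free ![x, y])
    (hx_law : P.IsLaw x (semicircularLaw 1)) (hy_law : P.IsLaw y (semicircularLaw 1)) :
    Measurable tetillaDensity ∧ (∀ t, 0 ≤ tetillaDensity t) ∧ HasCompactSupport tetillaDensity ∧
      ∀ μ : MeasureTheory.Measure ℝ,
        P.IsLaw (((1 / √2 : ℝ) : ℂ) • (x * y + y * x)) μ ↔
          μ = MeasureTheory.volume.withDensity fun t => ENNReal.ofReal (tetillaDensity t) := by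
  refine ⟨measurable_tetillaDensity, tetillaDensity_nonneg, hasCompactSupport_tetillaDensity,
    fun μ => ⟨fun hμ => ?_, ?_⟩⟩
  · have := hμ.1
    refine measure_eq_of_moments_eq (ν := tetillaMeasure) (by positivity) ae_abs_le_tetillaMeasure
      (fun n => (hμ.2 n).1) integrable_pow_tetillaMeasure fun n => ?_
    have e := (hμ.2 n).2
    rw [P.map_anticommutator_pow hxy hx_law hy_law] at e
    rw [integral_pow_tetillaMeasure]
    exact_mod_cast e.symm
  · rintro rfl
    refine ⟨isProbabilityMeasure_tetillaMeasure, fun n => ⟨integrable_pow_tetillaMeasure n, ?_⟩⟩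
    rw [P.map_anticommutator_pow hxy hx_law hy_law]
    exact congrArg _ (integral_pow_tetillaMeasure n).symm
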